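/- Let $\mathbb U=\bigcup_{h\ge 0}\{1,2,\dots\}^h$ be the Ulam–Harris tree (finite words; the root is the empty word and the $i$-th child of a word $u$ is $ui$). A rooted subtree of $\mathbb U$ is a non-empty finite subset $\tau\subset\mathbb U$ such that $ui\in\tau$ implies $u\in\tau$ for all $u\in\mathbb U$ and $i\ge1$; let $\mathfrak t_n$ be the set of rooted subtrees with exactly $n$ vertices. For $i\ge 1$ let $N_i(\tau)$ be the number of vertices of $\tau$ of the form $vi$ with $v\in\mathbb U$. Theorem. Let $\theta=(\theta_1,\theta_2,\dots)$ be a sequence of non-negative real numbers with $0<\sum_{i\ge1}\theta_i<\infty$. For $n\ge1$ let $\mathbf{ST}_n^\theta$ be the probability distribution on $\mathfrak t_n$ given by $$\mathbf{ST}_n^\theta(\tau)=\frac{\prod_{i\ge1}\theta_i^{N_i(\tau)}}{\sum_{\tau'\in\mathfrak t_n}\prod_{i\ge1}\theta_i^{N_i(\tau')}},\qquad \tau\in\mathfrak t_n$$ (with $0^0=1$). Then there are a probability space and random variables $\mathcal T_n$, $n\ge1$, defined on it, with $\mathcal T_n$ taking values in $\mathfrak t_n$, such that $\mathcal T_n$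 has law $\mathbf{ST}_n^\theta$ for every $n\ge1$, the process $(\mathcal T_n)_{n\ge1}$ is Markov (the conditional law of $\mathcal T_{n+1}$ given $\mathcal T_1,\dots,\mathcal T_n$ is its conditional law given $\mathcal T_n$), and $\mathcal T_1\subset\mathcal T_2\subset\mathcal T_3\subset\cdots\subset\mathbb U$. -/

import Mathlib

open MeasureTheory ProbabilityTheory

/-- The vertex set of the Ulam–Harris tree: finite words on the alphabet `{1, 2, …}`. The empty
word is the root, and the `i`-th child of the word `u` is `u ++ [i]`. -/
abbrev UlamHarris : Type := List ℕ+

/-- A rooted subtree of the Ulam–Harris tree: a non-empty finite set of words that is closed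
under taking parents. -/
def IsRootedSubtree (τ : Finset UlamHarris) : Prop :=
  τ.Nonempty ∧ ∀ (u : UlamHarris) (i : ℕ+), u ++ [i] ∈ τ → u ∈ τ

/-- The set of rooted subtrees of the Ulam–Harris tree that have `n` vertices. -/
@[ext]
structure RootedSubtree (n : ℕ) where
  verts : Finset UlamHarris
  isRootedSubtree : IsRootedSubtree verts
  card_verts : verts.card = n

/-- Rooted subtrees carry the discrete σ-algebra. -/
instance RootedSubtree.instMeasurableSpace (n : ℕ) : MeasurableSpace (RootedSubtree n) := ⊤

open Classical in
/-- The set of vertices of type `i` in `τ`: those that are the `i`-th child of their parent. -/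
noncomputable def verticesOfType (i : ℕ+) (τ : Finset UlamHarris) : Finset UlamHarris :=
  τ.filter fun u => ∃ v : UlamHarris, u = v ++ [i]

/-- The weight `∏ i, θ i ^ N i τ`, where `N i τ` is the number of vertices of type `i` in `τ`
(all but finitely many factors are `1`). -/
noncomputable def subtreeWeight (θ : ℕ+ → ℝ) (τ : Finset UlamHarris) : ℝ :=
  ∏ᶠ i : ℕ+, θ i ^ (verticesOfType i τ).card

/-- The total weight of the rooted subtrees with `n` vertices, as a sum in `[0, ∞]`. -/
noncomputable def subtreePartition (θ : ℕ+ → ℝ) (n : ℕ) : ENNReal :=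
  ∑' τ : RootedSubtree n, ENNReal.ofReal (subtreeWeight θ τ.verts)

/-- The measure on rooted subtrees with `n` vertices that gives each `τ` the mass
`subtreeWeight θ τ / subtreePartition θ n`. -/
noncomputable def subtreeMeasure (θ : ℕ+ → ℝ) (n : ℕ) : Measure (RootedSubtree n) :=
  Measure.sum fun τ : RootedSubtree n =>
    (ENNReal.ofReal (subtreeWeight θ τ.verts) / subtreePartition θ n) • Measure.dirac τ

/-- The Markov property of a process indexed by `1, 2, …` whose value at time `n` lies in the
(countable, discrete) space `S n`: the conditional law of the next state given the past is its
conditional law given the present, for every past of positive probability. -/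
def IsMarkovProcess {Ω : Type*} [MeasurableSpace Ω] (P : Measure Ω) {S : ℕ+ → Type*}
    (X : (n : ℕ+) → Ω → S n) : Prop :=
  ∀ (n : ℕ+) (x : (k : ℕ+) → S k), P {ω | ∀ k ≤ n, X k ω = x k} ≠ 0 →
    P[{ω | X (n + 1) ω = x (n + 1)} | {ω | ∀ k ≤ n, X k ω = x k}]
      = P[{ω | X (n + 1) ω = x (n + 1)} | {ω | X n ω = x n}]

/-!
Number the types from `0` and write `t j` for the weight of type `j`. A tree is built by offering
each new vertex to the branches at the root, in increasing order of type; a branch that declines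
passes it on to the forest of the later branches, and the accepting branch repeats the procedure
inside. Cutting off the branch of type `i` makes the weights of forests the Cauchy product of the
weights of that branch and of the remaining forest, so a law of the sizes of these two parts has to
be transported from the pairs of sum `n` to those of sum `n + 1` by unit steps. The monotone
transport does this, and its step probabilities lie in `[0, 1]` as soon as, for `q ≤ n`, the ratios
`b q / b (q + 1)` of the weights `b` of either part are at least the ratio `S n / S (n + 1)` of the
Cauchy product.

The weights are coefficients of `φ(T)`, where `T = x f(T)` and `f = ∏ j, (1 + t j X)`, for suitable
factors `φ` of `f`. All these factors have log-concave coefficients. Multiplication by a log-concave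
series preserves the likelihood-ratio order (a `2 × 2` Cauchy–Binet identity), and hence so does
each step of the recursion that computes the coefficients of `φ(T)`; this gives the bounds on the
ratios.
-/

/-! ### Log-concave power series and the likelihood-ratio order -/

section LogConcave

open Finset PowerSeries

variable {R : Type*} [CommRing R]

theorem coeff_zero_one_add_C_mul_X_mul (t : R) (f : PowerSeries R) :
    coeff 0 ((1 + C t * X) * f) = coeff 0 f := by
  simp

theorem coeff_succ_one_add_C_mul_X_mul (t : R) (f : PowerSeries R) (m : ℕ) :
    coeff (m + 1) ((1 + C t * X) * f) = coeff (m + 1) f + t * coeff m f := by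
  rw [add_mul, one_mul, map_add, mul_assoc, coeff_C_mul, coeff_succ_X_mul]

theorem coeff_mul_eq_sum_range (f φ : PowerSeries R) {j M : ℕ} (hj : j < M) :
    coeff j (f * φ) = ∑ m ∈ range M, (if m ≤ j then coeff (j - m) f else 0) * coeff m φ := by
  rw [mul_comm, coeff_mul, Nat.sum_antidiagonal_eq_sum_range_succ_mk]
  simp only [ite_mul, zero_mul, ← sum_filter]
  refine sum_congr (by ext; simp; omega) fun m _ => mul_comm _ _

variable [LinearOrder R]

/-- The power series with non-negative coefficients. -/
def CoeffNonneg (f : PowerSeries R) : Prop :=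
  ∀ m, 0 ≤ coeff m f

/-- Log-concavity of the coefficients, in the form that excludes internal zeros when the
coefficients are non-negative. -/
def LogConcave (f : PowerSeries R) : Prop :=
  ∀ a b k : ℕ, a ≤ b → coeff a f * coeff (b + k) f ≤ coeff (a + k) f * coeff b f

/-- The likelihood-ratio order of sequences: `v / u` is non-decreasing, with denominators
cleared. -/
def LikelihoodRatioLE (u v : ℕ → R) : Prop :=
  ∀ m m' : ℕ, m < m' → u m' * v m ≤ u m * v m'

/-- The ratios `b q / b (q + 1)`, `q ≤ n`, are at least `S n / S (n + 1)`, with denominators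
cleared. -/
def LagRatioDominates (b S : ℕ → R) : Prop :=
  ∀ n, ∀ q ≤ n, b (q + 1) * S n ≤ b q * S (n + 1)

theorem LogConcave.one : LogConcave (1 : PowerSeries R) := by
  intro a b k hab
  simp only [coeff_one]
  split_ifs <;> first | omega | simp

theorem LogConcave.of_succ {f : PowerSeries R}
    (hf : ∀ a b : ℕ, a ≤ b → coeff a f * coeff (b + 1) f ≤ coeff (a + 1) f * coeff b f) :
    LogConcave f := by
  intro a b k
  induction k generalizing a with
  | zero => simp
  | succ k ih =>
    intro hab
    rcases hab.eq_or_lt with rfl | hlt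
    · exact (mul_comm _ _).le
    · calc coeff a f * coeff (b + (k + 1)) f = coeff a f * coeff ((b + k) + 1) f := by
            rw [add_assoc]
        _ ≤ coeff (a + 1) f * coeff (b + k) f := hf a (b + k) (by omega)
        _ ≤ coeff (a + 1 + k) f * coeff b f := ih (a + 1) hlt
        _ = coeff (a + (k + 1)) f * coeff b f := by rw [add_assoc, add_comm 1 k]

variable [IsStrictOrderedRing R]

theorem CoeffNonneg.one : CoeffNonneg (1 : PowerSeries R) := fun m => by
  rw [coeff_one]
  split_ifs <;> simp

theorem CoeffNonneg.mul {f g : PowerSeries R} (hf : CoeffNonneg f) (hg : CoeffNonneg g) :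
    CoeffNonneg (f * g) := fun m => by
  rw [coeff_mul]
  exact sum_nonneg fun p _ => mul_nonneg (hf _) (hg _)

theorem CoeffNonneg.one_add_C_mul_X {a : R} (ha : 0 ≤ a) : CoeffNonneg (1 + C a * X) := fun m => by
  rw [map_add, coeff_C_mul, coeff_X]
  refine add_nonneg (CoeffNonneg.one m) (mul_nonneg ha ?_)
  split_ifs <;> simp

theorem LogConcave.one_add_C_mul_X_mul {f : PowerSeries R} {t : R} (ht : 0 ≤ t)
    (hf : LogConcave f) (hf₀ : CoeffNonneg f) : LogConcave ((1 + C t * X) * f) := by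
  refine LogConcave.of_succ fun a b hab => ?_
  rcases a with _ | a
  · rcases b with _ | b
    · exact (mul_comm _ _).le
    · simp only [coeff_zero_one_add_C_mul_X_mul, coeff_succ_one_add_C_mul_X_mul]
      have h01 := hf 0 (b + 1) 1 (by omega)
      simp only [zero_add] at h01 ⊢
      nlinarith [mul_nonneg ht (mul_nonneg (hf₀ 1) (hf₀ b)),
        mul_nonneg (mul_nonneg ht ht) (mul_nonneg (hf₀ 0) (hf₀ b))]
  · obtain ⟨b, rfl⟩ := Nat.exists_eq_add_of_lt hab
    simp only [coeff_succ_one_add_C_mul_X_mul]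
    have h1 := hf (a + 1) (a + b + 1) 1 (by omega)
    have h2 := mul_le_mul_of_nonneg_left (hf a (a + b) 1 (by omega)) (mul_nonneg ht ht)
    have h3 := mul_le_mul_of_nonneg_left (hf a (a + b) 2 (by omega)) ht
    nlinarith

theorem LikelihoodRatioLE.sum_mul_sum_le {u v φ ψ : ℕ → R} (huv : LikelihoodRatioLE u v)
    (hφψ : LikelihoodRatioLE φ ψ) (s : Finset ℕ) :
    (∑ j ∈ s, u j * ψ j) * (∑ j ∈ s, v j * φ j) ≤
      (∑ j ∈ s, u j * φ j) * (∑ j ∈ s, v j * ψ j) := by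
  have minor_nonneg : ∀ m m', 0 ≤ (u m * v m' - u m' * v m) * (φ m * ψ m' - φ m' * ψ m) := by
    intro m m'
    rcases lt_trichotomy m m' with h | rfl | h
    · exact mul_nonneg (sub_nonneg.2 (huv _ _ h)) (sub_nonneg.2 (hφψ _ _ h))
    · simp
    · exact mul_nonneg_of_nonpos_of_nonpos (sub_nonpos.2 (huv _ _ h)) (sub_nonpos.2 (hφψ _ _ h))
  have cauchy_binet : ∑ m ∈ s, ∑ m' ∈ s, (u m * v m' - u m' * v m) * (φ m * ψ m' - φ m' * ψ m) =
      (∑ j ∈ s, u j * φ j) * (∑ j ∈ s, v j * ψ j) - (∑ j ∈ s, u j * ψ j) * (∑ j ∈ s, v j * φ j)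
      - ((∑ j ∈ s, v j * φ j) * (∑ j ∈ s, u j * ψ j)
      - (∑ j ∈ s, v j * ψ j) * (∑ j ∈ s, u j * φ j)) := by
    simp only [sum_mul_sum, ← sum_sub_distrib]
    exact sum_congr rfl fun m _ => sum_congr rfl fun m' _ => by ring
  have := sum_nonneg fun m (_ : m ∈ s) => sum_nonneg fun m' (_ : m' ∈ s) => minor_nonneg m m'
  rw [cauchy_binet] at this
  nlinarith

theorem LogConcave.likelihoodRatioLE_reflect {f : PowerSeries R} (hf : LogConcave f)
    (hf₀ : CoeffNonneg f) {j j' : ℕ} (hj : j < j') :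
    LikelihoodRatioLE (fun m => if m ≤ j then coeff (j - m) f else 0)
      (fun m => if m ≤ j' then coeff (j' - m) f else 0) := by
  intro m m' hm
  have nonneg : ∀ i l, 0 ≤ if l ≤ i then coeff (i - l) f else 0 := fun i l => by
    split_ifs <;> simp [hf₀ _]
  by_cases hm' : m' ≤ j
  · have := hf (j - m') (j' - m') (m' - m) (by omega)
    rw [show j' - m' + (m' - m) = j' - m by omega, show j - m' + (m' - m) = j - m by omega] at this
    simpa [hm', show m ≤ j by omega, show m ≤ j' by omega, show m' ≤ j' by omega] using this
  · simpa only [if_neg hm', zero_mul] using mul_nonneg (nonneg j m) (nonneg j' m')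

theorem LogConcave.likelihoodRatioLE_mul_left {f φ ψ : PowerSeries R} (hf : LogConcave f)
    (hf₀ : CoeffNonneg f) (h : LikelihoodRatioLE (coeff · φ) (coeff · ψ)) :
    LikelihoodRatioLE (coeff · (f * φ)) (coeff · (f * ψ)) := by
  intro j j' hj
  simp only [coeff_mul_eq_sum_range f _ (show j < j' + 1 by omega),
    coeff_mul_eq_sum_range f _ (show j' < j' + 1 by omega)]
  rw [mul_comm]
  exact (hf.likelihoodRatioLE_reflect hf₀ hj).sum_mul_sum_le h _

theorem LogConcave.likelihoodRatioLE_mul_self {h c : PowerSeries R} (hh : LogConcave h)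
    (hh₀ : CoeffNonneg h) (hc : CoeffNonneg c) :
    LikelihoodRatioLE (coeff · h) (coeff · (h * c)) := by
  have one_le : LikelihoodRatioLE (coeff · (1 : PowerSeries R)) (coeff · c) := by
    intro m m' hm
    have : coeff m' (1 : PowerSeries R) = 0 := by rw [coeff_one, if_neg (by omega)]
    simpa only [this, zero_mul] using mul_nonneg (CoeffNonneg.one m) (hc m')
  simpa only [mul_one] using hh.likelihoodRatioLE_mul_left hh₀ one_le

theorem LagRatioDominates.of_logConvex {b S : ℕ → R} (hb : ∀ n, 0 ≤ b n) (hS : ∀ n, 0 ≤ S n)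
    (hconvex : ∀ n, b (n + 1) * b (n + 1) ≤ b n * b (n + 2))
    (hdiag : ∀ n, b (n + 1) * S n ≤ b n * S (n + 1)) : LagRatioDominates b S := by
  intro n q hq
  induction hq using Nat.decreasingInduction with
  | self => exact hdiag n
  | of_succ q _ ih =>
    rcases (hb (q + 1)).eq_or_lt with h0 | h0
    · rw [← h0, zero_mul]
      exact mul_nonneg (hb _) (hS _)
    · refine le_of_mul_le_mul_left ?_ h0
      calc b (q + 1) * (b (q + 1) * S n) = b (q + 1) * b (q + 1) * S n := by ring
        _ ≤ b q * b (q + 2) * S n := mul_le_mul_of_nonneg_right (hconvex q) (hS _)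
        _ = b q * (b (q + 2) * S n) := by ring
        _ ≤ b q * (b (q + 1) * S (n + 1)) := mul_le_mul_of_nonneg_left ih (hb _)
        _ = b (q + 1) * (b q * S (n + 1)) := by ring

end LogConcave

/-! ### Coefficients of `φ(T)` for the solution of `T = x f(T)` -/

section Lagrange

open Finset PowerSeries

variable {R : Type*} [CommRing R]

/-- The power series `(φ - φ(0)) / X`. -/
noncomputable def divX (φ : PowerSeries R) : PowerSeries R :=
  PowerSeries.mk fun m => coeff (m + 1) φ

@[simp]
theorem coeff_divX (φ : PowerSeries R) (m : ℕ) : coeff m (divX φ) = coeff (m + 1) φ :=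
  coeff_mk _ _

theorem divX_mul (φ ψ : PowerSeries R) :
    divX (φ * ψ) = divX φ * ψ + C (coeff 0 φ) * divX ψ := by
  ext m
  rw [map_add, coeff_C_mul, coeff_divX, coeff_divX, coeff_mul, coeff_mul, Nat.antidiagonal_succ,
    sum_cons, sum_map, add_comm]
  simp

/-- The coefficient of `xⁿ` in `φ(T)`, where `T` is the power series with `T = x f(T)`. The
recursion avoids substitution: `φ(T) = φ(0) + T (divX φ)(T) = φ(0) + x (f * divX φ)(T)`. -/
noncomputable def lagrangeCoeff (f : PowerSeries R) : ℕ → PowerSeries R → R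
  | 0, φ => coeff 0 φ
  | n + 1, φ => lagrangeCoeff f n (f * divX φ)

variable {f φ ψ : PowerSeries R}

theorem lagrangeCoeff_zero : lagrangeCoeff f 0 φ = coeff 0 φ := rfl

theorem lagrangeCoeff_succ (n : ℕ) :
    lagrangeCoeff f (n + 1) φ = lagrangeCoeff f n (f * divX φ) := rfl

theorem lagrangeCoeff_add (n : ℕ) :
    lagrangeCoeff f n (φ + ψ) = lagrangeCoeff f n φ + lagrangeCoeff f n ψ := by
  induction n generalizing φ ψ with
  | zero => exact map_add _ _ _
  | succ n ih =>
    have : divX (φ + ψ) = divX φ + divX ψ := by ext; simp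
    simp only [lagrangeCoeff_succ, this, mul_add, ih]

theorem lagrangeCoeff_C_mul (c : R) (n : ℕ) :
    lagrangeCoeff f n (C c * φ) = c * lagrangeCoeff f n φ := by
  induction n generalizing φ with
  | zero => exact coeff_C_mul _ _ _
  | succ n ih =>
    have : divX (C c * φ) = C c * divX φ := by ext; simp
    rw [lagrangeCoeff_succ, this, mul_left_comm, ih, lagrangeCoeff_succ]

theorem lagrangeCoeff_mul (n : ℕ) :
    lagrangeCoeff f n (φ * ψ) =
      ∑ p ∈ antidiagonal n, lagrangeCoeff f p.1 φ * lagrangeCoeff f p.2 ψ := by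
  induction n generalizing φ ψ with
  | zero => simp [lagrangeCoeff_zero]
  | succ n ih =>
    rw [lagrangeCoeff_succ, divX_mul, mul_add, ← mul_assoc, lagrangeCoeff_add, ih,
      mul_left_comm, lagrangeCoeff_C_mul, ← lagrangeCoeff_succ, Nat.antidiagonal_succ, sum_cons,
      sum_map, add_comm]
    rfl

variable [LinearOrder R]

theorem CoeffNonneg.divX (hφ : CoeffNonneg φ) : CoeffNonneg (divX φ) := fun m => by
  rw [coeff_divX]
  exact hφ _

variable [IsStrictOrderedRing R]

theorem lagrangeCoeff_nonneg (hf : CoeffNonneg f) (hφ : CoeffNonneg φ) (n : ℕ) :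
    0 ≤ lagrangeCoeff f n φ := by
  induction n generalizing φ with
  | zero => exact hφ 0
  | succ _ ih => exact ih (hf.mul hφ.divX)

theorem lagrangeCoeff_succ_pos (hf : CoeffNonneg f) (hf0 : 0 < coeff 0 f) (hf1 : 0 < coeff 1 f)
    (hφ : CoeffNonneg φ) (hφ1 : 0 < coeff 1 φ) (n : ℕ) : 0 < lagrangeCoeff f (n + 1) φ := by
  induction n generalizing φ with
  | zero => simpa [lagrangeCoeff_succ, lagrangeCoeff_zero, coeff_mul] using mul_pos hf0 hφ1
  | succ _ ih =>
    refine ih (hf.mul hφ.divX) ?_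
    have : 0 ≤ coeff 0 f * coeff 2 φ := mul_nonneg hf0.le (hφ 2)
    simpa [coeff_mul, Nat.antidiagonal_succ] using add_pos_of_nonneg_of_pos this (mul_pos hf1 hφ1)

theorem LikelihoodRatioLE.lagrangeCoeff_mul_le (hf : LogConcave f) (hf₀ : CoeffNonneg f)
    (h : LikelihoodRatioLE (coeff · φ) (coeff · ψ)) (n : ℕ) :
    lagrangeCoeff f n ψ * lagrangeCoeff f (n + 1) φ ≤
      lagrangeCoeff f n φ * lagrangeCoeff f (n + 1) ψ := by
  induction n generalizing φ ψ with
  | zero =>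
    have := mul_le_mul_of_nonneg_left (h 0 1 one_pos) (hf₀ 0)
    simp only [lagrangeCoeff_succ, lagrangeCoeff_zero, coeff_mul, Nat.antidiagonal_zero,
      sum_singleton, coeff_divX, zero_add]
    linarith
  | succ _ ih =>
    refine ih (hf.likelihoodRatioLE_mul_left hf₀ fun m m' hm => ?_)
    simpa only [coeff_divX] using h (m + 1) (m' + 1) (by omega)

variable {h G : PowerSeries R}

theorem lagrangeCoeff_mul_self_le (hf : LogConcave f) (hf₀ : CoeffNonneg f)
    (hh : LogConcave h) (hh₀ : CoeffNonneg h) (hG : CoeffNonneg G) (hfac : f = h * G) (n : ℕ) :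
    lagrangeCoeff f (n + 1) h * lagrangeCoeff f (n + 1) h ≤
      lagrangeCoeff f n h * lagrangeCoeff f (n + 2) h := by
  have hLR : LikelihoodRatioLE (coeff · h) (coeff · (f * _root_.divX h)) := by
    rw [hfac, mul_assoc]
    exact hh.likelihoodRatioLE_mul_self hh₀ (hG.mul hh₀.divX)
  exact hLR.lagrangeCoeff_mul_le hf hf₀ n

theorem LagRatioDominates.lagrangeCoeff {c : PowerSeries R} (hf : LogConcave f)
    (hf₀ : CoeffNonneg f) (hh : LogConcave h) (hh₀ : CoeffNonneg h) (hG : CoeffNonneg G)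
    (hfac : f = h * G) (hc : CoeffNonneg c) :
    LagRatioDominates (lagrangeCoeff f · h) (lagrangeCoeff f · (h * c)) := by
  refine .of_logConvex (lagrangeCoeff_nonneg hf₀ hh₀) (lagrangeCoeff_nonneg hf₀ (hh₀.mul hc))
    (lagrangeCoeff_mul_self_le hf hf₀ hh hh₀ hG hfac) fun n => ?_
  rw [mul_comm]
  exact (hh.likelihoodRatioLE_mul_self hh₀ hc).lagrangeCoeff_mul_le hf hf₀ n

end Lagrange

/-! ### Infinite products of linear factors -/

section ProdSeries

open Finset PowerSeries Filter Topology

variable {t : ℕ → ℝ}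

/-- The power series `∏ j, (1 + t j X)`, that is, the generating function of the elementary
symmetric functions of the sequence `t`; each coefficient is the supremum, and for non-negative
summable `t` the limit, of those of the partial products. -/
noncomputable def prodSeries (t : ℕ → ℝ) : PowerSeries ℝ :=
  PowerSeries.mk fun m => ⨆ N, coeff m (∏ j ∈ range N, (1 + C (t j) * X))

theorem CoeffNonneg.prod_one_add_C_mul_X (ht : ∀ j, 0 ≤ t j) (N : ℕ) :
    CoeffNonneg (∏ j ∈ range N, (1 + C (t j) * X)) :=
  prod_induction _ CoeffNonneg (fun _ _ => .mul) .one fun j _ => .one_add_C_mul_X (ht j)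

theorem LogConcave.prod_one_add_C_mul_X (ht : ∀ j, 0 ≤ t j) (N : ℕ) :
    LogConcave (∏ j ∈ range N, (1 + C (t j) * X)) := by
  induction N with
  | zero => exact LogConcave.one
  | succ N ih =>
    rw [prod_range_succ, mul_comm]
    exact ih.one_add_C_mul_X_mul (ht N) (.prod_one_add_C_mul_X ht N)

theorem coeff_prod_one_add_C_mul_X_le (ht : ∀ j, 0 ≤ t j) (N m : ℕ) :
    coeff m (∏ j ∈ range N, (1 + C (t j) * X)) ≤ ∏ j ∈ range N, (1 + t j) := by
  induction N generalizing m with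
  | zero =>
    rw [prod_range_zero, prod_range_zero, coeff_one]
    split_ifs <;> simp
  | succ N ih =>
    rw [prod_range_succ, prod_range_succ, mul_comm, mul_comm _ (1 + t N)]
    have h₀ : 0 ≤ ∏ j ∈ range N, (1 + t j) := prod_nonneg fun j _ => by linarith [ht j]
    rcases m with _ | m
    · rw [coeff_zero_one_add_C_mul_X_mul]
      nlinarith [ih 0, mul_nonneg (ht N) h₀]
    · rw [coeff_succ_one_add_C_mul_X_mul]
      nlinarith [ih (m + 1), mul_le_mul_of_nonneg_left (ih m) (ht N)]

theorem tendsto_coeff_prod_one_add_C_mul_X (ht : ∀ j, 0 ≤ t j) (hs : Summable t) (m : ℕ) :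
    Tendsto (fun N => coeff m (∏ j ∈ range N, (1 + C (t j) * X))) atTop
      (𝓝 (coeff m (prodSeries t))) := by
  have mono : Monotone fun N => coeff m (∏ j ∈ range N, (1 + C (t j) * X)) := by
    refine monotone_nat_of_le_succ fun N => ?_
    rw [prod_range_succ, mul_comm]
    rcases m with _ | m
    · rw [coeff_zero_one_add_C_mul_X_mul]
    · rw [coeff_succ_one_add_C_mul_X_mul]
      exact le_add_of_nonneg_right
        (mul_nonneg (ht N) (CoeffNonneg.prod_one_add_C_mul_X ht N m))
  rw [prodSeries, coeff_mk]
  refine tendsto_atTop_ciSup mono ⟨Real.exp (∑' j, t j), ?_⟩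
  rintro _ ⟨N, rfl⟩
  calc coeff m (∏ j ∈ range N, (1 + C (t j) * X)) ≤ ∏ j ∈ range N, (1 + t j) :=
        coeff_prod_one_add_C_mul_X_le ht N m
    _ ≤ Real.exp (∑ j ∈ range N, t j) := Real.prod_one_add_le_exp_sum _ ht
    _ ≤ Real.exp (∑' j, t j) := Real.exp_le_exp.2 (hs.sum_le_tsum _ fun j _ => ht j)

theorem CoeffNonneg.prodSeries (ht : ∀ j, 0 ≤ t j) (hs : Summable t) :
    CoeffNonneg (prodSeries t) := fun m =>
  ge_of_tendsto' (tendsto_coeff_prod_one_add_C_mul_X ht hs m) fun N =>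
    CoeffNonneg.prod_one_add_C_mul_X ht N m

theorem LogConcave.prodSeries (ht : ∀ j, 0 ≤ t j) (hs : Summable t) :
    LogConcave (prodSeries t) := fun a b k hab =>
  have lim := tendsto_coeff_prod_one_add_C_mul_X ht hs
  le_of_tendsto_of_tendsto' ((lim a).mul (lim (b + k))) ((lim (a + k)).mul (lim b)) fun N =>
    LogConcave.prod_one_add_C_mul_X ht N a b k hab

theorem coeff_zero_prodSeries : coeff 0 (prodSeries t) = 1 := by
  have : ∀ N, coeff 0 (∏ j ∈ range N, (1 + C (t j) * X)) = 1 := fun N => by simp [map_prod]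
  simp only [prodSeries, coeff_mk, this, ciSup_const]

theorem coeff_one_prodSeries (ht : ∀ j, 0 ≤ t j) (hs : Summable t) :
    coeff 1 (prodSeries t) = ∑' j, t j := by
  have : ∀ N, coeff 1 (∏ j ∈ range N, (1 + C (t j) * X)) = ∑ j ∈ range N, t j := fun N => by
    induction N with
    | zero => simp [coeff_one]
    | succ N ih =>
      have h0 : coeff 0 (∏ j ∈ range N, (1 + C (t j) * X)) = 1 := by simp [map_prod]
      rw [prod_range_succ, mul_comm, coeff_succ_one_add_C_mul_X_mul, ih, h0, mul_one,
        sum_range_succ]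
  refine tendsto_nhds_unique (tendsto_coeff_prod_one_add_C_mul_X ht hs 1) ?_
  simpa only [this] using hs.tendsto_sum_tsum_nat

theorem prodSeries_eq_mul (ht : ∀ j, 0 ≤ t j) (hs : Summable t) :
    prodSeries t = (1 + C (t 0) * X) * prodSeries fun j => t (j + 1) := by
  ext m
  refine tendsto_nhds_unique
    ((tendsto_coeff_prod_one_add_C_mul_X ht hs m).comp (tendsto_add_atTop_nat 1)) ?_
  have lim := tendsto_coeff_prod_one_add_C_mul_X (fun j => ht (j + 1))
    ((summable_nat_add_iff 1).2 hs)
  simp only [Function.comp_def, prod_range_succ', mul_comm _ (1 + C (t 0) * X)]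
  rcases m with _ | m
  · simpa only [coeff_zero_one_add_C_mul_X_mul] using lim 0
  · simpa only [coeff_succ_one_add_C_mul_X_mul] using (lim (m + 1)).add ((lim m).const_mul (t 0))

/-- The power series `∏ j ≥ i, (1 + t j X)`. -/
noncomputable def tailSeries (t : ℕ → ℝ) (i : ℕ) : PowerSeries ℝ :=
  prodSeries fun j => t (i + j)

theorem tailSeries_zero : tailSeries t 0 = prodSeries t := by
  simp [tailSeries]

theorem coeff_zero_tailSeries (i : ℕ) : coeff 0 (tailSeries t i) = 1 :=
  coeff_zero_prodSeries

theorem summable_add_left (hs : Summable t) (i : ℕ) : Summable fun j => t (i + j) := by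
  simpa only [add_comm i] using (summable_nat_add_iff i).2 hs

theorem CoeffNonneg.tailSeries (ht : ∀ j, 0 ≤ t j) (hs : Summable t) (i : ℕ) :
    CoeffNonneg (tailSeries t i) :=
  .prodSeries (fun _ => ht _) (summable_add_left hs i)

theorem LogConcave.tailSeries (ht : ∀ j, 0 ≤ t j) (hs : Summable t) (i : ℕ) :
    LogConcave (tailSeries t i) :=
  .prodSeries (fun _ => ht _) (summable_add_left hs i)

theorem coeff_one_tailSeries (ht : ∀ j, 0 ≤ t j) (hs : Summable t) (i : ℕ) :
    coeff 1 (tailSeries t i) = ∑' j, t (i + j) :=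
  coeff_one_prodSeries (fun _ => ht _) (summable_add_left hs i)

theorem tailSeries_eq_mul (ht : ∀ j, 0 ≤ t j) (hs : Summable t) (i : ℕ) :
    tailSeries t i = (1 + C (t i) * X) * tailSeries t (i + 1) := by
  rw [tailSeries, prodSeries_eq_mul (fun _ => ht _) (summable_add_left hs i), tailSeries]
  simp only [add_zero, add_comm, add_left_comm]

theorem exists_prodSeries_eq_tailSeries_mul (ht : ∀ j, 0 ≤ t j) (hs : Summable t) (i : ℕ) :
    ∃ G, CoeffNonneg G ∧ prodSeries t = tailSeries t i * G := by
  induction i with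
  | zero => exact ⟨1, .one, by rw [tailSeries_zero, mul_one]⟩
  | succ i ih =>
    obtain ⟨G, hG, h⟩ := ih
    exact ⟨(1 + C (t i) * X) * G, (CoeffNonneg.one_add_C_mul_X (ht i)).mul hG, by
      rw [h, tailSeries_eq_mul ht hs i]; ring⟩

end ProdSeries

/-! ### Monotone transport between consecutive levels of a Cauchy product -/

section Transport

open Finset

variable {K : Type*} [Field K]

/-- The Cauchy product of two sequences. -/
def cauchyProd (a b : ℕ → K) (n : ℕ) : K :=
  ∑ l ∈ range (n + 1), a l * b (n - l)

/-- The mass that has to move from `(k, m)` to `(k + 1, m)` when the weights `a k * b m` on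
`k + m = n` are transported, by unit steps, to `r` times those on `k + m = n + 1`. -/
def transportFlow (a b : ℕ → K) (r : K) (k m : ℕ) : K :=
  ∑ l ∈ range (k + 1), a l * (b (k + m - l) - b (k + m + 1 - l) * r)

open Classical in
/-- The conditional probability of the step `(k, m) → (k + 1, m)`, as opposed to
`(k, m) → (k, m + 1)`, in the transport of the normalised weights `a k * b m` on `k + m = n` to
those on `k + m = n + 1`. It is set to `0` if there is no mass to transport to. -/
noncomputable def transportProb (a b : ℕ → K) (k m : ℕ) : K :=
  if cauchyProd a b (k + m + 1) = 0 then 0 else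
    transportFlow a b (cauchyProd a b (k + m) / cauchyProd a b (k + m + 1)) k m / (a k * b m)

/-- The ratio of the previous value of a sequence to the present one, with the convention that
the value before the initial one is `0`. -/
def lagRatio (c : ℕ → K) : ℕ → K
  | 0 => 0
  | n + 1 => c n / c (n + 1)

variable {a b : ℕ → K}

@[simp]
theorem lagRatio_zero (c : ℕ → K) : lagRatio c 0 = 0 := rfl

theorem lagRatio_succ (c : ℕ → K) (n : ℕ) : lagRatio c (n + 1) = c n / c (n + 1) := rfl

theorem cauchyProd_eq_add {n i j : ℕ} (hn : n + 1 = i + j) :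
    cauchyProd a b n = ∑ l ∈ range i, a l * b (n - l) + ∑ l ∈ range j, b l * a (n - l) := by
  rw [cauchyProd, hn, sum_range_add, ← sum_range_reflect fun l => b l * a (n - l)]
  congr 1
  refine sum_congr rfl fun l hl => ?_
  have := mem_range.1 hl
  rw [mul_comm, show n - (i + l) = j - 1 - l by omega, show n - (j - 1 - l) = i + l by omega]

theorem transportFlow_eq_sub (r : K) (k m : ℕ) :
    transportFlow a b r k m = ∑ l ∈ range (k + 1), a l * b (k + m - l) -
      r * ∑ l ∈ range (k + 1), a l * b (k + m + 1 - l) := by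
  rw [transportFlow, mul_sum, ← sum_sub_distrib]
  exact sum_congr rfl fun l _ => by ring

theorem transportFlow_add_swap {r : K} {k m : ℕ}
    (hr : cauchyProd a b (k + m) = r * cauchyProd a b (k + m + 1)) :
    transportFlow a b r k m + transportFlow b a r m k = a k * b m := by
  rw [cauchyProd_eq_add (show k + m + 1 = k + 1 + m by ring),
    cauchyProd_eq_add (show k + m + 1 + 1 = k + 1 + (m + 1) by ring)] at hr
  rw [transportFlow_eq_sub, transportFlow_eq_sub, add_comm m k,
    sum_range_succ (fun l => b l * a (k + m - l)), Nat.add_sub_cancel]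
  linear_combination hr

theorem transportFlow_succ (r : K) (k m : ℕ) :
    transportFlow a b r (k + 1) m =
      transportFlow a b r k (m + 1) + a (k + 1) * (b m - b (m + 1) * r) := by
  rw [transportFlow, sum_range_succ, transportFlow, show k + 1 + m - (k + 1) = m by omega,
    show k + 1 + m + 1 - (k + 1) = m + 1 by omega, show k + (m + 1) = k + 1 + m by ring]

theorem transportProb_zero_left (ha : a 0 ≠ 0) {m : ℕ} (hb : ∀ n, b n ≠ 0)
    (hS : cauchyProd a b (m + 1) ≠ 0) :
    (1 - transportProb a b 0 m) * lagRatio b (m + 1) = lagRatio (cauchyProd a b) (m + 1) := by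
  have hbm := hb m
  have hbm' := hb (m + 1)
  rw [transportProb, zero_add, if_neg hS, transportFlow, lagRatio_succ, lagRatio_succ]
  simp only [zero_add, sum_range_one, Nat.sub_zero]
  field_simp
  ring

theorem transportProb_zero_right (hb : b 0 ≠ 0) {k : ℕ} (ha : ∀ n, a n ≠ 0)
    (hS : cauchyProd a b (k + 1) ≠ 0) :
    transportProb a b k 0 * lagRatio a (k + 1) = lagRatio (cauchyProd a b) (k + 1) := by
  have hak := ha k
  have hak' := ha (k + 1)
  set r := cauchyProd a b k / cauchyProd a b (k + 1) with hr
  have flow : transportFlow a b r k 0 = b 0 * a (k + 1) * r := by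
    have := transportFlow_add_swap (a := a) (b := b) (k := k) (m := 0) (div_mul_cancel₀ _ hS).symm
    simp only [transportFlow, add_zero, zero_add, sum_range_one, Nat.sub_zero, ← hr] at this ⊢
    linear_combination this
  rw [transportProb, add_zero, if_neg hS, ← hr, flow, lagRatio_succ, lagRatio_succ, ← hr]
  field_simp

theorem transportProb_succ_succ {k m : ℕ} (ha : ∀ n, a n ≠ 0) (hb : ∀ n, b n ≠ 0)
    (hS : cauchyProd a b (k + m + 2) ≠ 0) :
    transportProb a b k (m + 1) * lagRatio a (k + 1) +
      (1 - transportProb a b (k + 1) m) * lagRatio b (m + 1) =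
        lagRatio (cauchyProd a b) (k + m + 2) := by
  have hak := ha k
  have hak' := ha (k + 1)
  have hbm := hb m
  have hbm' := hb (m + 1)
  rw [transportProb, transportProb, show k + (m + 1) = k + m + 1 by ring,
    show k + 1 + m = k + m + 1 by ring, if_neg hS, if_neg hS, transportFlow_succ,
    lagRatio_succ, lagRatio_succ, lagRatio_succ]
  generalize transportFlow a b _ k (m + 1) = F
  field_simp
  ring

/-- A pair at `(k, m)` was reached from `(k - 1, m)` or from `(k, m - 1)`; in the recursion of
lagged ratios the impossible step is discarded by `lagRatio c 0 = 0`. -/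
theorem lagRatio_cauchyProd {k m : ℕ} (ha₀ : a 0 ≠ 0) (hb₀ : b 0 ≠ 0)
    (ha : k ≠ 0 → ∀ n, a n ≠ 0) (hb : m ≠ 0 → ∀ n, b n ≠ 0)
    (hS : k + m ≠ 0 → cauchyProd a b (k + m) ≠ 0) :
    lagRatio (cauchyProd a b) (k + m) = transportProb a b (k - 1) m * lagRatio a k +
      (1 - transportProb a b k (m - 1)) * lagRatio b m := by
  rcases k with _ | k <;> rcases m with _ | m
  · simp
  · simpa using (transportProb_zero_left ha₀ (hb (by omega)) (by simpa using hS)).symm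
  · simpa using (transportProb_zero_right hb₀ (ha (by omega)) (by simpa using hS)).symm
  · have hS' : cauchyProd a b (k + m + 2) ≠ 0 := by
      rw [show k + m + 2 = k + 1 + (m + 1) by ring]
      exact hS (by omega)
    rw [show k + 1 + (m + 1) = k + m + 2 by ring]
    exact (transportProb_succ_succ (ha (by omega)) (hb (by omega)) hS').symm

theorem transportProb_eq_zero (ha₀ : a 0 = 1) (ha : ∀ n, a (n + 1) = 0) (k m : ℕ) :
    transportProb a b k m = 0 := by
  have hS : cauchyProd a b = b := by
    ext n
    simp [cauchyProd, sum_range_succ', ha, ha₀]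
  rw [transportProb, hS]
  split_ifs with h
  · rfl
  · rw [transportFlow, sum_range_succ', sum_eq_zero fun l _ => by rw [ha, zero_mul], Nat.sub_zero,
      Nat.sub_zero, mul_div_cancel₀ _ h, sub_self, mul_zero, zero_add, zero_div]

theorem transportProb_eq_one (hb₀ : b 0 = 1) (hb : ∀ n, b (n + 1) = 0) (ha : ∀ n, a n ≠ 0)
    (k : ℕ) : transportProb a b k 0 = 1 := by
  have hS : cauchyProd a b = a := by
    ext n
    rw [cauchyProd_eq_add (show n + 1 = 0 + (n + 1) by ring), sum_range_zero, zero_add,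
      sum_range_succ']
    simp [hb, hb₀]
  have := transportProb_zero_right (b := b) (by simp [hb₀]) ha (hS ▸ ha (k + 1))
  rw [hS, lagRatio_succ] at this
  exact mul_right_cancel₀ (div_ne_zero (ha k) (ha (k + 1))) (by rw [this, one_mul])

variable [LinearOrder K] [IsStrictOrderedRing K]

theorem transportFlow_nonneg {r : K} {k m : ℕ} (ha : ∀ n, 0 ≤ a n)
    (h : ∀ q ≤ k + m, b (q + 1) * r ≤ b q) : 0 ≤ transportFlow a b r k m := by
  refine sum_nonneg fun l hl => mul_nonneg (ha l) (sub_nonneg.2 ?_)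
  rw [mem_range] at hl
  rw [show k + m + 1 - l = k + m - l + 1 by omega]
  exact h _ (by omega)

theorem LagRatioDominates.mul_div_le {b S : ℕ → K} (h : LagRatioDominates b S)
    {n : ℕ} (hS : 0 < S (n + 1)) {q : ℕ} (hq : q ≤ n) : b (q + 1) * (S n / S (n + 1)) ≤ b q := by
  rw [mul_div_assoc', div_le_iff₀ hS]
  exact h n q hq

theorem cauchyProd_nonneg (ha : ∀ n, 0 ≤ a n) (hb : ∀ n, 0 ≤ b n) (n : ℕ) :
    0 ≤ cauchyProd a b n :=
  sum_nonneg fun _ _ => mul_nonneg (ha _) (hb _)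

theorem transportProb_nonneg (ha : ∀ n, 0 ≤ a n) (hb : ∀ n, 0 ≤ b n)
    (hbS : LagRatioDominates b (cauchyProd a b)) (k m : ℕ) : 0 ≤ transportProb a b k m := by
  rw [transportProb]
  split_ifs with h
  · rfl
  · have hS := (cauchyProd_nonneg ha hb _).lt_of_ne' h
    exact div_nonneg (transportFlow_nonneg ha fun q => hbS.mul_div_le hS)
      (mul_nonneg (ha _) (hb _))

theorem transportProb_le_one (ha : ∀ n, 0 ≤ a n) (hb : ∀ n, 0 ≤ b n)
    (haS : LagRatioDominates a (cauchyProd a b)) (k m : ℕ) : transportProb a b k m ≤ 1 := by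
  rw [transportProb]
  split_ifs with h
  · exact zero_le_one
  · have hS := (cauchyProd_nonneg ha hb _).lt_of_ne' h
    refine div_le_one_of_le₀ ?_ (mul_nonneg (ha _) (hb _))
    rw [← transportFlow_add_swap (div_mul_cancel₀ _ h).symm]
    exact le_add_of_nonneg_right
      (transportFlow_nonneg hb fun q hq => haS.mul_div_le hS (hq.trans (add_comm m k).le))

end Transport

theorem sum_prod_mul_add_prod_mul {R : Type*} [CommRing R] {ρ x q : ℕ → R}
    (h : ∀ j, ρ j = x j + q j * ρ (j + 1)) (M : ℕ) :
    ∑ j ∈ Finset.range M, (∏ l ∈ Finset.range j, q l) * x j + (∏ l ∈ Finset.range M, q l) * ρ M =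
      ρ 0 := by
  induction M with
  | zero => simp
  | succ M ih =>
    rw [← ih, h M, Finset.sum_range_succ, Finset.prod_range_succ]
    ring

/-! ### Weights of trees and forests of given size -/

section Weights

open Finset PowerSeries

variable {t : ℕ → ℝ}

/-- The total weight of the trees with `n` vertices (and `1` for the empty tree). Their generating
function solves `T = x ∏ j, (1 + t j T)`. -/
noncomputable def treeWeight (t : ℕ → ℝ) (n : ℕ) : ℝ :=
  lagrangeCoeff (prodSeries t) n (1 + X)

/-- The total weight of the possibly empty trees with `n` vertices attached by an edge of
type `i`. -/
noncomputable def branchWeight (t : ℕ → ℝ) (i n : ℕ) : ℝ :=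
  lagrangeCoeff (prodSeries t) n (1 + C (t i) * X)

/-- The total weight of the forests with `n` vertices attached by edges of types `≥ i`. -/
noncomputable def forestWeight (t : ℕ → ℝ) (i n : ℕ) : ℝ :=
  lagrangeCoeff (prodSeries t) n (tailSeries t i)

@[simp]
theorem treeWeight_zero : treeWeight t 0 = 1 := by
  simp [treeWeight, lagrangeCoeff_zero]

@[simp]
theorem branchWeight_zero (i : ℕ) : branchWeight t i 0 = 1 := by
  simp [branchWeight, lagrangeCoeff_zero]

@[simp]
theorem forestWeight_zero (i : ℕ) : forestWeight t i 0 = 1 :=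
  coeff_zero_tailSeries i

theorem divX_one_add_C_mul_X (c : ℝ) : divX (1 + C c * X : PowerSeries ℝ) = C c := by
  ext m
  rw [coeff_divX, map_add, coeff_one, if_neg m.succ_ne_zero, zero_add, coeff_C_mul, coeff_X,
    coeff_C]
  simp

theorem treeWeight_succ (n : ℕ) : treeWeight t (n + 1) = forestWeight t 0 n := by
  have := divX_one_add_C_mul_X 1
  rw [map_one, one_mul] at this
  rw [treeWeight, forestWeight, lagrangeCoeff_succ, this, mul_one, tailSeries_zero]

theorem branchWeight_succ (i n : ℕ) : branchWeight t i (n + 1) = t i * treeWeight t (n + 1) := by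
  rw [branchWeight, lagrangeCoeff_succ, divX_one_add_C_mul_X, mul_comm, lagrangeCoeff_C_mul,
    treeWeight_succ, forestWeight, tailSeries_zero]

theorem forestWeight_one (ht : ∀ j, 0 ≤ t j) (hs : Summable t) (i : ℕ) :
    forestWeight t i 1 = ∑' j, t (i + j) := by
  rw [forestWeight, lagrangeCoeff_succ, lagrangeCoeff_zero, coeff_mul, Nat.antidiagonal_zero,
    sum_singleton, coeff_zero_prodSeries, coeff_divX, one_mul, coeff_one_tailSeries ht hs]

theorem forestWeight_eq_cauchyProd (ht : ∀ j, 0 ≤ t j) (hs : Summable t) (i : ℕ) :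
    forestWeight t i = cauchyProd (branchWeight t i) (forestWeight t (i + 1)) := by
  ext n
  rw [forestWeight, tailSeries_eq_mul ht hs, lagrangeCoeff_mul,
    Nat.sum_antidiagonal_eq_sum_range_succ_mk]
  rfl

theorem branchWeight_nonneg (ht : ∀ j, 0 ≤ t j) (hs : Summable t) (i n : ℕ) :
    0 ≤ branchWeight t i n :=
  lagrangeCoeff_nonneg (.prodSeries ht hs) (.one_add_C_mul_X (ht i)) n

theorem forestWeight_nonneg (ht : ∀ j, 0 ≤ t j) (hs : Summable t) (i n : ℕ) :
    0 ≤ forestWeight t i n :=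
  lagrangeCoeff_nonneg (.prodSeries ht hs) (.tailSeries ht hs i) n

theorem tsum_tail_pos (ht : ∀ j, 0 ≤ t j) (hs : Summable t) {i : ℕ} (hi : ∃ j ≥ i, 0 < t j) :
    0 < ∑' j, t (i + j) := by
  obtain ⟨j, hij, hj⟩ := hi
  refine (summable_add_left hs i).tsum_pos (fun _ => ht _) (j - i) ?_
  rwa [Nat.add_sub_cancel' hij]

theorem forestWeight_pos (ht : ∀ j, 0 ≤ t j) (hs : Summable t) {i : ℕ} (hi : ∃ j ≥ i, 0 < t j)
    (n : ℕ) : 0 < forestWeight t i n := by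
  rcases n with _ | n
  · simp
  have hpos := tsum_tail_pos ht hs (i := 0) ⟨hi.choose, Nat.zero_le _, hi.choose_spec.2⟩
  refine lagrangeCoeff_succ_pos (.prodSeries ht hs) ?_ ?_ (.tailSeries ht hs i) ?_ n
  · rw [coeff_zero_prodSeries]
    exact one_pos
  · simpa only [coeff_one_prodSeries ht hs, zero_add] using hpos
  · rw [coeff_one_tailSeries ht hs]
    exact tsum_tail_pos ht hs hi

theorem treeWeight_pos (ht : ∀ j, 0 ≤ t j) (hs : Summable t) (hpos : ∃ j, 0 < t j) (n : ℕ) :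
    0 < treeWeight t n := by
  rcases n with _ | n
  · simp
  · rw [treeWeight_succ]
    exact forestWeight_pos ht hs (by simpa using hpos) n

theorem branchWeight_pos (ht : ∀ j, 0 ≤ t j) (hs : Summable t) {i : ℕ} (hi : 0 < t i) (n : ℕ) :
    0 < branchWeight t i n := by
  rcases n with _ | n
  · simp
  · rw [branchWeight_succ]
    exact mul_pos hi (treeWeight_pos ht hs ⟨i, hi⟩ _)

theorem lagRatioDominates_branchWeight (ht : ∀ j, 0 ≤ t j) (hs : Summable t) (i : ℕ) :
    LagRatioDominates (branchWeight t i) (forestWeight t i) := by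
  obtain ⟨G, hG, hfac⟩ := exists_prodSeries_eq_tailSeries_mul ht hs i
  have hlc : LogConcave (1 + C (t i) * X) := by
    simpa only [mul_one] using LogConcave.one.one_add_C_mul_X_mul (ht i) .one
  have tail₀ : CoeffNonneg (tailSeries t (i + 1)) := .tailSeries ht hs (i + 1)
  simp only [funext fun n => show forestWeight t i n = _ by
    rw [forestWeight, tailSeries_eq_mul ht hs]]
  exact .lagrangeCoeff (.prodSeries ht hs) (.prodSeries ht hs) hlc (.one_add_C_mul_X (ht i))
    (tail₀.mul hG) (by rw [hfac, tailSeries_eq_mul ht hs, mul_assoc]) tail₀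

theorem lagRatioDominates_forestWeight_succ (ht : ∀ j, 0 ≤ t j) (hs : Summable t) (i : ℕ) :
    LagRatioDominates (forestWeight t (i + 1)) (forestWeight t i) := by
  obtain ⟨G, hG, hfac⟩ := exists_prodSeries_eq_tailSeries_mul ht hs (i + 1)
  simp only [funext fun n => show forestWeight t i n = _ by
    rw [forestWeight, tailSeries_eq_mul ht hs, mul_comm]]
  exact .lagrangeCoeff (.prodSeries ht hs) (.prodSeries ht hs) (.tailSeries ht hs (i + 1))
    (.tailSeries ht hs (i + 1)) hG hfac (.one_add_C_mul_X (ht i))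

end Weights

/-! ### Growth probabilities -/

section GrowProb

open Filter Topology

variable {t : ℕ → ℝ} {k m : ℕ → ℕ}

/-- The probability that a forest with edges of types `≥ i`, `k` vertices of which lie in the
branch of type `i` and `m` in the others, grows in the branch of type `i`. -/
noncomputable def growProb (t : ℕ → ℝ) (i k m : ℕ) : ℝ :=
  transportProb (branchWeight t i) (forestWeight t (i + 1)) k m

theorem growProb_nonneg (ht : ∀ j, 0 ≤ t j) (hs : Summable t) (i k m : ℕ) :
    0 ≤ growProb t i k m :=
  transportProb_nonneg (branchWeight_nonneg ht hs i) (forestWeight_nonneg ht hs _)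
    (forestWeight_eq_cauchyProd ht hs i ▸ lagRatioDominates_forestWeight_succ ht hs i) k m

theorem growProb_le_one (ht : ∀ j, 0 ≤ t j) (hs : Summable t) (i k m : ℕ) :
    growProb t i k m ≤ 1 :=
  transportProb_le_one (branchWeight_nonneg ht hs i) (forestWeight_nonneg ht hs _)
    (forestWeight_eq_cauchyProd ht hs i ▸ lagRatioDominates_branchWeight ht hs i) k m

theorem growProb_eq_zero {i : ℕ} (hi : t i = 0) (k m : ℕ) : growProb t i k m = 0 :=
  transportProb_eq_zero (branchWeight_zero i) (fun n => by simp [branchWeight_succ, hi]) k m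

theorem growProb_last_eq_one (ht : ∀ j, 0 ≤ t j) (hs : Summable t) {i : ℕ} (hi : 0 < t i)
    (hlast : ∀ j > i, t j = 0) (k : ℕ) : growProb t i k 0 = 1 := by
  have tail : tailSeries t (i + 1) = 1 := by
    have : ∀ j, t (i + 1 + j) = 0 := fun j => hlast _ (by omega)
    ext m
    simp [tailSeries, prodSeries, this, PowerSeries.coeff_one]
  refine transportProb_eq_one (forestWeight_zero _) (fun n => ?_)
    (fun n => (branchWeight_pos ht hs hi n).ne') k
  have : divX (1 : PowerSeries ℝ) = 0 := by ext; simp [PowerSeries.coeff_one]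
  simpa [forestWeight, tail, lagrangeCoeff_succ, this] using
    lagrangeCoeff_C_mul (f := prodSeries t) (φ := 0) 0 n

/-- The branch sizes `k j` of a forest, and their tail sums `m i = ∑ j ≥ i, k j`, with branches
only where `t` is positive. -/
structure BranchSizes (t : ℕ → ℝ) (k m : ℕ → ℕ) : Prop where
  eq_add : ∀ j, m j = k j + m (j + 1)
  eventually_zero : ∃ M, ∀ j, M ≤ j → m j = 0
  pos : ∀ j, k j ≠ 0 → 0 < t j

theorem BranchSizes.exists_pos (h : BranchSizes t k m) {i : ℕ} (hi : m i ≠ 0) :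
    ∃ j ≥ i, 0 < t j := by
  by_contra! hcon
  have hm : ∀ n, m (i + n) = m i := fun n => by
    induction n with
    | zero => rfl
    | succ n ih =>
      have hk : k (i + n) = 0 := by
        by_contra hk
        exact (hcon _ (Nat.le_add_right i n)).not_gt (h.pos _ hk)
      rw [← ih, h.eq_add (i + n), hk, zero_add, add_assoc]
  obtain ⟨M, hM⟩ := h.eventually_zero
  exact hi (by rw [← hm M, hM _ (by omega)])

theorem BranchSizes.lagRatio_forestWeight (h : BranchSizes t k m) (ht : ∀ j, 0 ≤ t j)
    (hs : Summable t) (i : ℕ) :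
    lagRatio (forestWeight t i) (m i) =
      growProb t i (k i - 1) (m (i + 1)) * lagRatio (branchWeight t i) (k i) +
        (1 - growProb t i (k i) (m (i + 1) - 1)) *
          lagRatio (forestWeight t (i + 1)) (m (i + 1)) := by
  have hS : m i ≠ 0 → forestWeight t i (m i) ≠ 0 := fun hi =>
    (forestWeight_pos ht hs (h.exists_pos hi) _).ne'
  rw [h.eq_add i, forestWeight_eq_cauchyProd ht hs] at hS ⊢
  exact lagRatio_cauchyProd (by simp) (by simp)
    (fun hk n => (branchWeight_pos ht hs (h.pos i hk) n).ne')
    (fun hm n => (forestWeight_pos ht hs (h.exists_pos hm) n).ne') hS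

theorem BranchSizes.sum_growProb (h : BranchSizes t k m) (ht : ∀ j, 0 ≤ t j) (hs : Summable t)
    {M : ℕ} (hM : m M = 0) :
    ∑ j ∈ Finset.range M, (∏ l ∈ Finset.range j, (1 - growProb t l (k l) (m (l + 1) - 1))) *
      (growProb t j (k j - 1) (m (j + 1)) * lagRatio (branchWeight t j) (k j)) =
        lagRatio (forestWeight t 0) (m 0) := by
  simpa [hM] using sum_prod_mul_add_prod_mul (h.lagRatio_forestWeight ht hs) M

theorem one_sub_growProb_mul_tail (ht : ∀ j, 0 ≤ t j) (hs : Summable t) {i : ℕ}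
    (hi : ∃ j > i, 0 < t j) :
    (1 - growProb t i 0 0) * ∑' j, t (i + j) = ∑' j, t (i + 1 + j) := by
  have hpos := tsum_tail_pos ht hs (i := i + 1) hi
  have hpos' := tsum_tail_pos ht hs (i := i) (hi.imp fun j hj => ⟨hj.1.le, hj.2⟩)
  have hS : cauchyProd (branchWeight t i) (forestWeight t (i + 1)) 1 ≠ 0 := by
    rw [← forestWeight_eq_cauchyProd ht hs, forestWeight_one ht hs]
    exact hpos'.ne'
  have := transportProb_zero_left (m := 0) (by simp)
    (fun n => (forestWeight_pos ht hs (i := i + 1) hi n).ne') hS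
  rw [← forestWeight_eq_cauchyProd ht hs, lagRatio_succ, lagRatio_succ, zero_add,
    forestWeight_one ht hs, forestWeight_one ht hs, forestWeight_zero, forestWeight_zero] at this
  rw [growProb]
  field_simp at this
  exact this

theorem BranchSizes.prod_eventually_zero_of_last (h : BranchSizes t k m) (ht : ∀ j, 0 ≤ t j)
    (hs : Summable t) {i : ℕ} (hi : 0 < t i) (hlast : ∀ j > i, t j = 0) :
    ∀ᶠ n in atTop, ∏ l ∈ Finset.range n, (1 - growProb t l (k l) (m (l + 1))) = 0 := by
  have hm : m (i + 1) = 0 := by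
    by_contra hm
    obtain ⟨j, hij, hj⟩ := h.exists_pos hm
    exact hj.ne' (hlast j hij)
  filter_upwards [eventually_gt_atTop i] with n hn
  exact Finset.prod_eq_zero (Finset.mem_range.2 hn)
    (by rw [hm, growProb_last_eq_one ht hs hi hlast, sub_self])

theorem BranchSizes.tendsto_prod_of_infinite (h : BranchSizes t k m) (ht : ∀ j, 0 ≤ t j)
    (hs : Summable t) (hinf : ∀ i, ∃ j > i, 0 < t j) :
    Tendsto (fun n => ∏ l ∈ Finset.range n, (1 - growProb t l (k l) (m (l + 1)))) atTop (𝓝 0) := by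
  obtain ⟨M, hM⟩ := h.eventually_zero
  set g : ℕ → ℝ := fun l => 1 - growProb t l (k l) (m (l + 1)) with hg
  have hMpos := tsum_tail_pos ht hs (i := M) ((hinf M).imp fun j hj => ⟨hj.1.le, hj.2⟩)
  have step : ∀ l, M ≤ l → g l * ∑' j, t (l + j) = ∑' j, t (l + 1 + j) := fun l hl => by
    have := h.eq_add l
    rw [hM l hl, hM (l + 1) (by omega)] at this
    rw [← one_sub_growProb_mul_tail ht hs (hinf l)]
    simp only [hg, hM (l + 1) (by omega), show k l = 0 by omega]
  have prod_eq : ∀ n, ∏ l ∈ Finset.range (n + M), g l =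
      (∏ l ∈ Finset.range M, g l) / (∑' j, t (M + j)) * ∑' j, t (n + M + j) := fun n => by
    induction n with
    | zero => rw [zero_add, div_mul_cancel₀ _ hMpos.ne']
    | succ n ih =>
      rw [show n + 1 + M = n + M + 1 by ring, Finset.prod_range_succ, ih, ← step _ (by omega)]
      ring
  have tail : Tendsto (fun n => ∑' j, t (n + M + j)) atTop (𝓝 0) := by
    simpa only [Function.comp_def, add_comm, add_left_comm] using
      (tendsto_sum_nat_add t).comp (tendsto_add_atTop_nat M)
  rw [← tendsto_add_atTop_iff_nat M]
  simpa only [prod_eq, mul_zero] using tail.const_mul _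

theorem BranchSizes.tendsto_prod (h : BranchSizes t k m) (ht : ∀ j, 0 ≤ t j) (hs : Summable t)
    (hpos : ∃ j, 0 < t j) :
    Tendsto (fun n => ∏ l ∈ Finset.range n, (1 - growProb t l (k l) (m (l + 1)))) atTop (𝓝 0) := by
  by_cases hinf : ∀ i, ∃ j > i, 0 < t j
  · exact h.tendsto_prod_of_infinite ht hs hinf
  · obtain ⟨i, hi, hlast⟩ : ∃ i, 0 < t i ∧ ∀ j > i, t j = 0 := by
      push Not at hinf
      obtain ⟨N, hN⟩ := hinf
      have hN' : ∀ j, 0 < t j → j ≤ N := fun j hj => not_lt.1 fun h => (hN j h).not_gt hj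
      classical
      obtain ⟨j, hj⟩ := hpos
      have hspec := Nat.findGreatest_spec (P := fun j => 0 < t j) (hN' j hj) hj
      refine ⟨_, hspec, fun l hl => (ht l).eq_of_not_lt' fun hl₀ => ?_⟩
      exact (Nat.findGreatest_is_greatest hl (hN' l hl₀)) hl₀
    exact tendsto_const_nhds.congr' ((h.prod_eventually_zero_of_last ht hs hi hlast).mono
      fun n hn => hn.symm)

theorem BranchSizes.hasSum_growProb (h : BranchSizes t k m) (ht : ∀ j, 0 ≤ t j)
    (hs : Summable t) (hpos : ∃ j, 0 < t j) :
    HasSum (fun j => (∏ l ∈ Finset.range j, (1 - growProb t l (k l) (m (l + 1)))) *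
      growProb t j (k j) (m (j + 1))) 1 := by
  rw [hasSum_iff_tendsto_nat_of_nonneg fun j => mul_nonneg (Finset.prod_nonneg fun l _ =>
    sub_nonneg.2 (growProb_le_one ht hs _ _ _)) (growProb_nonneg ht hs _ _ _)]
  have telescope := sum_prod_mul_add_prod_mul (ρ := fun _ => (1 : ℝ))
    (x := fun j => growProb t j (k j) (m (j + 1)))
    (q := fun j => 1 - growProb t j (k j) (m (j + 1))) fun j => by ring
  simp only [mul_one, ← eq_sub_iff_add_eq] at telescope
  simpa only [telescope, sub_zero] using (h.tendsto_prod ht hs hpos).const_sub 1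

end GrowProb

/-! ### Branches of a tree -/

section Branches

variable {τ : Finset UlamHarris}

/-- The branch of `τ` at the root along the letter `i`: the words `v` such that `i :: v` lies in
`τ`. -/
noncomputable def subtreeAt (τ : Finset UlamHarris) (i : ℕ+) : Finset UlamHarris :=
  τ.preimage (fun v => i :: v) List.cons_injective.injOn

/-- The number of vertices of the branch of `τ` of type `j`. Types are counted from `0` here, so
that this is the branch along the letter `j + 1`. -/
noncomputable def branchSize (τ : Finset UlamHarris) (j : ℕ) : ℕ :=
  (subtreeAt τ j.succPNat).card

open Classical in
/-- The number of vertices of the branches of `τ` of types `≥ j`, counted from `0`. -/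
noncomputable def tailSize (τ : Finset UlamHarris) (j : ℕ) : ℕ :=
  (τ.filter fun u => ∃ (i : ℕ+) (v : UlamHarris), u = i :: v ∧ j ≤ i.natPred).card

/-- A possibly empty tree: a set of words that contains the parents of its elements. -/
def ParentClosed (τ : Finset UlamHarris) : Prop :=
  ∀ (u : UlamHarris) (i : ℕ+), u ++ [i] ∈ τ → u ∈ τ

@[simp]
theorem mem_subtreeAt {i : ℕ+} {v : UlamHarris} : v ∈ subtreeAt τ i ↔ i :: v ∈ τ := by
  simp [subtreeAt]

theorem ParentClosed.subtreeAt (h : ParentClosed τ) (i : ℕ+) : ParentClosed (subtreeAt τ i) := by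
  intro u j hu
  rw [mem_subtreeAt] at hu ⊢
  exact h (i :: u) j hu

theorem ParentClosed.mem_of_append_mem (h : ParentClosed τ) (u v : UlamHarris) (hv : u ++ v ∈ τ) :
    u ∈ τ := by
  induction v using List.reverseRecOn with
  | nil => simpa using hv
  | append_singleton v i ih => exact ih (h _ i (by simpa using hv))

theorem ParentClosed.nil_mem (h : ParentClosed τ) (hne : τ.Nonempty) : [] ∈ τ := by
  obtain ⟨u, hu⟩ := hne
  exact h.mem_of_append_mem [] u hu

theorem card_subtreeAt_lt (hτ : [] ∈ τ) (i : ℕ+) : (subtreeAt τ i).card < τ.card := by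
  classical
  calc (subtreeAt τ i).card = ((subtreeAt τ i).image (i :: ·)).card :=
        (Finset.card_image_of_injective _ List.cons_injective).symm
    _ ≤ (τ.erase []).card := Finset.card_le_card fun u hu => by
        obtain ⟨v, hv, rfl⟩ := Finset.mem_image.1 hu
        simpa using hv
    _ < τ.card := Finset.card_erase_lt_of_mem hτ

theorem tailSize_eq_add (τ : Finset UlamHarris) (j : ℕ) :
    tailSize τ j = branchSize τ j + tailSize τ (j + 1) := by
  classical
  rw [branchSize, ← Finset.card_image_of_injective _ (List.cons_injective (a := j.succPNat)),
    tailSize, tailSize, ← Finset.card_union_of_disjoint]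
  · congr 1
    ext u
    simp only [Finset.mem_filter, Finset.mem_union, Finset.mem_image, mem_subtreeAt]
    constructor
    · rintro ⟨hu, i, v, rfl, hi⟩
      rcases hi.eq_or_lt with rfl | hi
      · exact Or.inl ⟨v, by simpa using hu, by simp⟩
      · exact Or.inr ⟨hu, i, v, rfl, hi⟩
    · rintro (⟨v, hv, rfl⟩ | ⟨hu, i, v, rfl, hi⟩)
      · exact ⟨hv, _, _, rfl, by simp⟩
      · exact ⟨hu, _, _, rfl, by omega⟩
  · simp [Finset.disjoint_left]

theorem tailSize_zero (hτ : [] ∈ τ) : tailSize τ 0 = τ.card - 1 := by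
  classical
  rw [tailSize, ← Finset.card_erase_of_mem hτ]
  congr 1
  ext u
  rcases u with _ | ⟨i, v⟩ <;> simp

theorem exists_natPred_lt (τ : Finset UlamHarris) :
    ∃ M, ∀ (i : ℕ+) (v : UlamHarris), i :: v ∈ τ → i.natPred < M := by
  let firstType : UlamHarris → ℕ := fun u => u.head?.elim 0 PNat.natPred
  exact ⟨τ.sup firstType + 1, fun i v hv => Nat.lt_succ_of_le (Finset.le_sup (f := firstType) hv)⟩

theorem tailSize_eq_zero {M : ℕ} (hM : ∀ (i : ℕ+) (v : UlamHarris), i :: v ∈ τ → i.natPred < M)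
    {j : ℕ} (hj : M ≤ j) : tailSize τ j = 0 := by
  classical
  rw [tailSize, Finset.card_eq_zero, Finset.filter_eq_empty_iff]
  rintro u hu ⟨i, v, rfl, hi⟩
  exact (hM i v hu).not_ge (hj.trans hi)

theorem subtreeAt_erase_self (i : ℕ+) (v : UlamHarris) :
    subtreeAt (τ.erase (i :: v)) i = (subtreeAt τ i).erase v := by
  ext w; simp

theorem branchSize_erase_self {j : ℕ} {v : UlamHarris} (hv : j.succPNat :: v ∈ τ) :
    branchSize (τ.erase (j.succPNat :: v)) j = branchSize τ j - 1 := by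
  rw [branchSize, subtreeAt_erase_self, Finset.card_erase_of_mem (by simpa using hv), branchSize]

theorem branchSize_erase_of_ne {j l : ℕ} (h : l ≠ j) (v : UlamHarris) :
    branchSize (τ.erase (j.succPNat :: v)) l = branchSize τ l := by
  rw [branchSize, branchSize]
  congr 1
  ext w
  simp [Nat.succPNat_injective.ne h]

theorem tailSize_erase_of_le {j l : ℕ} (h : l ≤ j) {v : UlamHarris} (hv : j.succPNat :: v ∈ τ) :
    tailSize (τ.erase (j.succPNat :: v)) l = tailSize τ l - 1 := by
  classical
  rw [tailSize, tailSize, Finset.filter_erase, Finset.card_erase_of_mem]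
  exact Finset.mem_filter.2 ⟨hv, _, _, rfl, by simpa using h⟩

theorem tailSize_erase_of_lt {j l : ℕ} (h : j < l) (v : UlamHarris) :
    tailSize (τ.erase (j.succPNat :: v)) l = tailSize τ l := by
  classical
  rw [tailSize, tailSize, Finset.filter_erase, Finset.erase_eq_of_notMem]
  simp [h]

theorem sum_eq_nil_add_sum_subtreeAt (f : UlamHarris → ℝ) (hτ : [] ∈ τ) {M : ℕ}
    (hM : ∀ (i : ℕ+) (v : UlamHarris), i :: v ∈ τ → i.natPred < M) :
    ∑ u ∈ τ, f u = f [] + ∑ j ∈ Finset.range M,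
      ∑ v ∈ subtreeAt τ j.succPNat, f (j.succPNat :: v) := by
  classical
  rw [← Finset.add_sum_erase _ _ hτ, Finset.sum_sigma']
  congr 1
  refine (Finset.sum_bij (fun p _ => p.1.succPNat :: p.2) ?_ ?_ ?_ fun _ _ => rfl).symm
  · rintro ⟨j, v⟩ hp
    simpa using (Finset.mem_sigma.1 hp).2
  · rintro ⟨j, v⟩ _ ⟨l, w⟩ _ h
    obtain ⟨hjl, rfl⟩ := List.cons.inj h
    obtain rfl := Nat.succPNat_injective hjl
    rfl
  · rintro (_ | ⟨i, v⟩) hu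
    · simp at hu
    · have hv := Finset.mem_of_mem_erase hu
      exact ⟨⟨i.natPred, v⟩, by simpa using ⟨hM i v hv, hv⟩, by simp⟩

theorem tsum_eq_nil_add_tsum_cons (f : UlamHarris → ENNReal) :
    ∑' u, f u = f [] + ∑' (j : ℕ) (v : UlamHarris), f (j.succPNat :: v) := by
  have hinj : Function.Injective fun p : ℕ × UlamHarris => p.1.succPNat :: p.2 := by
    rintro ⟨j, v⟩ ⟨l, w⟩ h
    obtain ⟨h1, h2⟩ := List.cons.inj h
    exact Prod.ext (Nat.succPNat_injective h1) h2
  rw [ENNReal.tsum_eq_add_tsum_ite [], ← hinj.tsum_eq, ENNReal.tsum_prod']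
  · simp
  · rintro (_ | ⟨i, v⟩) h
    · simp at h
    · exact ⟨(i.natPred, v), by simp⟩

end Branches

/-! ### Growing a tree by one vertex -/

section Growth

variable {t : ℕ → ℝ} {τ : Finset UlamHarris}

/-- The weight of a vertex: that of its type, or `1` for the root. -/
noncomputable def vertexWeight (t : ℕ → ℝ) (u : UlamHarris) : ℝ :=
  u.getLast?.elim 1 fun i => t i.natPred

/-- The probability that the nonempty tree `τ` grows in its branch of type `j`: the types are
offered the new vertex in increasing order, and each accepts with its `growProb`. -/
noncomputable def branchProb (t : ℕ → ℝ) (τ : Finset UlamHarris) (j : ℕ) : ℝ :=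
  (∏ l ∈ Finset.range j, (1 - growProb t l (branchSize τ l) (tailSize τ (l + 1)))) *
    growProb t j (branchSize τ j) (tailSize τ (j + 1))

/-- The probability that the possibly empty tree `τ` grows by the vertex `u`. -/
noncomputable def growthProb (t : ℕ → ℝ) : UlamHarris → Finset UlamHarris → ℝ
  | [], τ => if τ = ∅ then 1 else 0
  | i :: v, τ => if τ = ∅ then 0 else branchProb t τ i.natPred * growthProb t v (subtreeAt τ i)

@[simp]
theorem vertexWeight_nil : vertexWeight t [] = 1 := rfl

theorem vertexWeight_cons (i : ℕ+) (v : UlamHarris) :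
    vertexWeight t (i :: v) = if v = [] then t i.natPred else vertexWeight t v := by
  rcases v with _ | ⟨j, v⟩
  · simp [vertexWeight]
  · simp [vertexWeight, List.getLast?_cons_cons]

theorem vertexWeight_nonneg (ht : ∀ j, 0 ≤ t j) (u : UlamHarris) : 0 ≤ vertexWeight t u := by
  rw [vertexWeight]
  cases u.getLast? <;> simp [ht]

theorem vertexWeight_pos_of_mem_subtreeAt (h : ∀ u ∈ τ, 0 < vertexWeight t u) (i : ℕ+) :
    ∀ v ∈ subtreeAt τ i, 0 < vertexWeight t v := by
  intro v hv
  have := h _ (mem_subtreeAt.1 hv)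
  rw [vertexWeight_cons] at this
  split_ifs at this with hnil
  · simp [hnil]
  · exact this

theorem ParentClosed.branchSizes (h : ParentClosed τ) (hw : ∀ u ∈ τ, 0 < vertexWeight t u) :
    BranchSizes t (branchSize τ) (tailSize τ) where
  eq_add := tailSize_eq_add τ
  eventually_zero := (exists_natPred_lt τ).imp fun _ hM _ hj => tailSize_eq_zero hM hj
  pos j hj := by
    obtain ⟨v, hv⟩ := Finset.card_pos.1 (Nat.pos_of_ne_zero hj)
    have := hw _ (h.mem_of_append_mem [j.succPNat] v (by simpa using hv))
    simpa [vertexWeight_cons] using this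

theorem branchProb_nonneg (ht : ∀ j, 0 ≤ t j) (hs : Summable t) (τ : Finset UlamHarris) (j : ℕ) :
    0 ≤ branchProb t τ j :=
  mul_nonneg (Finset.prod_nonneg fun _ _ => sub_nonneg.2 (growProb_le_one ht hs _ _ _))
    (growProb_nonneg ht hs _ _ _)

theorem branchProb_erase {j : ℕ} {v : UlamHarris} (hv : j.succPNat :: v ∈ τ) :
    branchProb t (τ.erase (j.succPNat :: v)) j =
      (∏ l ∈ Finset.range j, (1 - growProb t l (branchSize τ l) (tailSize τ (l + 1) - 1))) *
        growProb t j (branchSize τ j - 1) (tailSize τ (j + 1)) := by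
  rw [branchProb, branchSize_erase_self hv, tailSize_erase_of_lt (by omega)]
  congr 1
  refine Finset.prod_congr rfl fun l hl => ?_
  have := Finset.mem_range.1 hl
  rw [branchSize_erase_of_ne (by omega), tailSize_erase_of_le (by omega) hv]

theorem growthProb_nonneg (ht : ∀ j, 0 ≤ t j) (hs : Summable t) (u : UlamHarris)
    (τ : Finset UlamHarris) : 0 ≤ growthProb t u τ := by
  induction u generalizing τ with
  | nil => rw [growthProb]; split_ifs <;> simp
  | cons i v ih =>
    rw [growthProb]
    split_ifs
    · exact le_rfl
    · exact mul_nonneg (branchProb_nonneg ht hs _ _) (ih _)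

theorem growthProb_nil_empty : growthProb t [] ∅ = 1 := if_pos rfl

theorem growthProb_nil_of_nonempty (h : τ.Nonempty) : growthProb t [] τ = 0 := if_neg h.ne_empty

theorem growthProb_cons_of_nonempty (h : τ.Nonempty) (i : ℕ+) (v : UlamHarris) :
    growthProb t (i :: v) τ = branchProb t τ i.natPred * growthProb t v (subtreeAt τ i) :=
  if_neg h.ne_empty

theorem nonempty_of_growthProb_cons_ne_zero {i : ℕ+} {v : UlamHarris}
    (h : growthProb t (i :: v) τ ≠ 0) : τ.Nonempty := by
  by_contra hne
  exact h (if_pos (Finset.not_nonempty_iff_eq_empty.1 hne))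

theorem lagRatio_branchWeight {j : ℕ} (hj : t j ≠ 0) (n : ℕ) :
    lagRatio (branchWeight t j) n =
      if n = 1 then lagRatio (treeWeight t) n / t j else lagRatio (treeWeight t) n := by
  rcases n with _ | _ | n
  · simp
  · simp [lagRatio_succ, branchWeight_succ, div_eq_mul_inv, mul_comm]
  · rw [lagRatio_succ, lagRatio_succ, branchWeight_succ, branchWeight_succ,
      mul_div_mul_left _ _ hj, if_neg (by omega)]

theorem sum_growthProb_erase_div_vertexWeight_cons {j : ℕ} (hc : ParentClosed τ)
    (hj : τ.Nonempty → t j ≠ 0)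
    (h : ∑ v ∈ τ, growthProb t v (τ.erase v) / vertexWeight t v =
      lagRatio (treeWeight t) τ.card) :
    ∑ v ∈ τ, growthProb t v (τ.erase v) / vertexWeight t (j.succPNat :: v) =
      lagRatio (branchWeight t j) τ.card := by
  rcases τ.eq_empty_or_nonempty with rfl | hne
  · simp
  have hnil := hc.nil_mem hne
  rw [lagRatio_branchWeight (hj hne), ← h]
  split_ifs with h1
  · obtain ⟨a, rfl⟩ := Finset.card_eq_one.1 h1
    obtain rfl : [] = a := by simpa using hnil
    simp [vertexWeight_cons]
  · refine Finset.sum_congr rfl fun v _ => ?_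
    rw [vertexWeight_cons]
    split_ifs with hv₀
    · have hcard : 1 < τ.card := by have := Finset.card_pos.2 hne; omega
      rw [hv₀, growthProb_nil_of_nonempty ((Finset.erase_nonempty hnil).2
        (Finset.one_lt_card_iff_nontrivial.1 hcard)), zero_div, zero_div]
    · rfl

theorem growthProb_nil_erase_nil_add (hτ : [] ∈ τ) :
    growthProb t [] (τ.erase []) + lagRatio (forestWeight t 0) (τ.card - 1) =
      lagRatio (treeWeight t) τ.card := by
  obtain ⟨n, hn⟩ := Nat.exists_eq_add_one_of_ne_zero (Finset.card_ne_zero_of_mem hτ)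
  rcases n with _ | n
  · obtain ⟨a, rfl⟩ := Finset.card_eq_one.1 hn
    obtain rfl : [] = a := by simpa using hτ
    simp [growthProb_nil_empty, lagRatio_succ, treeWeight_succ]
  · rw [growthProb_nil_of_nonempty ((Finset.erase_nonempty hτ).2
      (Finset.one_lt_card_iff_nontrivial.1 (by omega))), hn]
    simp [lagRatio_succ, treeWeight_succ]

theorem sum_growthProb_erase_div_vertexWeight (ht : ∀ j, 0 ≤ t j) (hs : Summable t)
    (hc : ParentClosed τ) (hw : ∀ u ∈ τ, 0 < vertexWeight t u) :
    ∑ u ∈ τ, growthProb t u (τ.erase u) / vertexWeight t u =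
      lagRatio (treeWeight t) τ.card := by
  induction hn : τ.card using Nat.strong_induction_on generalizing τ with
  | _ n ih =>
  rcases τ.eq_empty_or_nonempty with rfl | hne
  · simp [← hn]
  have hτ := hc.nil_mem hne
  obtain ⟨M, hM⟩ := exists_natPred_lt τ
  have hB := hc.branchSizes hw
  have branch : ∀ j, ∑ v ∈ subtreeAt τ j.succPNat,
      growthProb t (j.succPNat :: v) (τ.erase (j.succPNat :: v)) /
        vertexWeight t (j.succPNat :: v) =
      (∏ l ∈ Finset.range j, (1 - growProb t l (branchSize τ l) (tailSize τ (l + 1) - 1))) *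
        (growProb t j (branchSize τ j - 1) (tailSize τ (j + 1)) *
          lagRatio (branchWeight t j) (branchSize τ j)) := fun j => by
    rw [branchSize, ← sum_growthProb_erase_div_vertexWeight_cons (hc.subtreeAt _)
      (fun h => (hB.pos j (Finset.card_pos.2 h).ne').ne')
      (ih _ (hn ▸ card_subtreeAt_lt hτ _) (hc.subtreeAt _)
        (vertexWeight_pos_of_mem_subtreeAt hw _) rfl), ← mul_assoc, Finset.mul_sum]
    refine Finset.sum_congr rfl fun v hv => ?_
    rw [mem_subtreeAt] at hv
    rw [growthProb_cons_of_nonempty ⟨_, Finset.mem_erase.2 ⟨by simp, hτ⟩⟩, subtreeAt_erase_self,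
      Nat.natPred_succPNat, branchProb_erase hv, branchSize, mul_div_assoc]
  rw [sum_eq_nil_add_sum_subtreeAt _ hτ hM, Finset.sum_congr rfl fun j _ => branch j,
    hB.sum_growProb ht hs (tailSize_eq_zero hM le_rfl), tailSize_zero hτ, vertexWeight_nil,
    div_one, growthProb_nil_erase_nil_add hτ, hn]

theorem tsum_growthProb (ht : ∀ j, 0 ≤ t j) (hs : Summable t) (hpos : ∃ j, 0 < t j)
    (hc : ParentClosed τ) (hw : ∀ u ∈ τ, 0 < vertexWeight t u) :
    ∑' u, ENNReal.ofReal (growthProb t u τ) = 1 := by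
  induction hn : τ.card using Nat.strong_induction_on generalizing τ with
  | _ n ih =>
  rw [tsum_eq_nil_add_tsum_cons]
  rcases τ.eq_empty_or_nonempty with rfl | hne
  · simp [growthProb]
  have branch : ∀ j : ℕ, ∑' v, ENNReal.ofReal (growthProb t (j.succPNat :: v) τ) =
      ENNReal.ofReal (branchProb t τ j) := fun j => by
    simp only [growthProb_cons_of_nonempty hne, Nat.natPred_succPNat,
      ENNReal.ofReal_mul (branchProb_nonneg ht hs τ j)]
    rw [ENNReal.tsum_mul_left, ih _ (hn ▸ card_subtreeAt_lt (hc.nil_mem hne) _) (hc.subtreeAt _)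
      (vertexWeight_pos_of_mem_subtreeAt hw _) rfl, mul_one]
  have total : HasSum (branchProb t τ) 1 := (hc.branchSizes hw).hasSum_growProb ht hs hpos
  rw [growthProb_nil_of_nonempty hne, ENNReal.ofReal_zero, zero_add, tsum_congr branch,
    ← ENNReal.ofReal_tsum_of_nonneg (branchProb_nonneg ht hs τ) total.summable, total.tsum_eq,
    ENNReal.ofReal_one]

theorem append_notMem_of_growthProb_ne_zero {u : UlamHarris} (h : growthProb t u τ ≠ 0)
    (v : UlamHarris) : u ++ v ∉ τ := by
  induction u generalizing τ with
  | nil =>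
    rcases τ.eq_empty_or_nonempty with rfl | hne
    · simp
    · exact absurd (growthProb_nil_of_nonempty hne) h
  | cons i u ih =>
    rw [growthProb_cons_of_nonempty (nonempty_of_growthProb_cons_ne_zero h)] at h
    simpa using ih (right_ne_zero_of_mul h)

theorem notMem_of_growthProb_ne_zero {u : UlamHarris} (h : growthProb t u τ ≠ 0) : u ∉ τ := by
  simpa using append_notMem_of_growthProb_ne_zero h []

theorem ParentClosed.erase_of_growthProb_ne_zero {u : UlamHarris} (hc : ParentClosed τ)
    (h : growthProb t u (τ.erase u) ≠ 0) : ParentClosed (τ.erase u) := by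
  intro v i hv
  refine Finset.mem_erase.2 ⟨?_, hc v i (Finset.mem_of_mem_erase hv)⟩
  rintro rfl
  exact append_notMem_of_growthProb_ne_zero h [i] hv

theorem ParentClosed.insert_of_growthProb_ne_zero {u : UlamHarris} (hc : ParentClosed τ)
    (h : growthProb t u τ ≠ 0) : ParentClosed (insert u τ) := by
  suffices hu : ∀ v i, u = v ++ [i] → v ∈ τ by
    intro v i hv
    rcases Finset.mem_insert.1 hv with hv | hv
    · exact Finset.mem_insert_of_mem (hu v i hv.symm)
    · exact Finset.mem_insert_of_mem (hc v i hv)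
  induction u generalizing τ with
  | nil => simp
  | cons a u ih =>
    have hne := nonempty_of_growthProb_cons_ne_zero h
    rw [growthProb_cons_of_nonempty hne] at h
    rintro (_ | ⟨b, v⟩) i huv
    · exact hc.nil_mem hne
    · obtain ⟨rfl, rfl⟩ := List.cons.inj huv
      exact mem_subtreeAt.1 (ih (hc.subtreeAt a) (right_ne_zero_of_mul h) v i rfl)

theorem vertexWeight_pos_of_growthProb_ne_zero (ht : ∀ j, 0 ≤ t j) {u : UlamHarris}
    (h : growthProb t u τ ≠ 0) : 0 < vertexWeight t u := by
  induction u generalizing τ with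
  | nil => simp
  | cons i v ih =>
    have hne := nonempty_of_growthProb_cons_ne_zero h
    rw [growthProb_cons_of_nonempty hne] at h
    rw [vertexWeight_cons]
    split_ifs
    · refine (ht _).lt_of_ne' fun hi => left_ne_zero_of_mul h ?_
      rw [branchProb, growProb_eq_zero hi, mul_zero]
    · exact ih (right_ne_zero_of_mul h)

end Growth

/-! ### The laws of the growing tree -/

section TreeLaw

variable {t : ℕ → ℝ} {n : ℕ} {τ : Finset UlamHarris}

open Classical in
/-- The law on possibly empty trees with `n` vertices under which each has a probability
proportional to the product of its vertex weights. -/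
noncomputable def treeLaw (t : ℕ → ℝ) (n : ℕ) (τ : Finset UlamHarris) : ENNReal :=
  if ParentClosed τ ∧ τ.card = n then
    ENNReal.ofReal ((∏ u ∈ τ, vertexWeight t u) / treeWeight t n) else 0

open Classical in
/-- The transition probabilities of the growing tree: `τ` becomes `insert u τ` with probability
`growthProb t u τ`. The value at those `τ` for which these do not add up to `1` is irrelevant. -/
noncomputable def growthKernel (t : ℕ → ℝ) (τ : Finset UlamHarris) : PMF (Finset UlamHarris) :=
  if h : ∑' u, ENNReal.ofReal (growthProb t u τ) = 1 then
    PMF.map (insert · τ) ⟨fun u => ENNReal.ofReal (growthProb t u τ), h ▸ ENNReal.summable.hasSum⟩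
  else PMF.pure ∅

theorem parentClosed_card_of_treeLaw_ne_zero (h : treeLaw t n τ ≠ 0) :
    ParentClosed τ ∧ τ.card = n := by
  by_contra hτ
  exact h (if_neg hτ)

theorem vertexWeight_pos_of_treeLaw_ne_zero (ht : ∀ j, 0 ≤ t j) (h : treeLaw t n τ ≠ 0) :
    ∀ u ∈ τ, 0 < vertexWeight t u := by
  intro u hu
  refine (vertexWeight_nonneg ht u).lt_of_ne' fun h₀ => h ?_
  simp [treeLaw, Finset.prod_eq_zero hu h₀]

theorem treeLaw_zero (t : ℕ → ℝ) : treeLaw t 0 = PMF.pure ∅ := by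
  ext τ
  have : ParentClosed ∅ := fun _ _ => False.elim ∘ Finset.notMem_empty _
  by_cases hτ : τ = ∅ <;> simp [treeLaw, hτ, this]

theorem treeLaw_erase_mul_growthProb (ht : ∀ j, 0 ≤ t j) (hs : Summable t)
    (hpos : ∃ j, 0 < t j) {u : UlamHarris} (hu : u ∈ τ) :
    treeLaw t n (τ.erase u) * ENNReal.ofReal (growthProb t u (τ.erase u)) =
      treeLaw t (n + 1) τ * ENNReal.ofReal (treeWeight t (n + 1) / treeWeight t n *
        (growthProb t u (τ.erase u) / vertexWeight t u)) := by
  by_cases hg : growthProb t u (τ.erase u) = 0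
  · simp [hg]
  have hw := vertexWeight_pos_of_growthProb_ne_zero ht hg
  have hz := treeWeight_pos ht hs hpos
  have hiff : ParentClosed (τ.erase u) ∧ (τ.erase u).card = n ↔
      ParentClosed τ ∧ τ.card = n + 1 := by
    rw [← Finset.card_erase_add_one hu, Nat.add_right_cancel_iff]
    refine and_congr_left fun _ => ⟨fun h => ?_, fun h => h.erase_of_growthProb_ne_zero hg⟩
    simpa only [Finset.insert_erase hu] using h.insert_of_growthProb_ne_zero hg
  have hprod : ∀ s : Finset UlamHarris, 0 ≤ ∏ u ∈ s, vertexWeight t u := fun s =>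
    Finset.prod_nonneg fun u _ => vertexWeight_nonneg ht u
  by_cases h : ParentClosed τ ∧ τ.card = n + 1
  · rw [treeLaw, treeLaw, if_pos (hiff.2 h), if_pos h,
      ← ENNReal.ofReal_mul (div_nonneg (hprod _) (hz n).le),
      ← ENNReal.ofReal_mul (div_nonneg (hprod _) (hz (n + 1)).le),
      ← Finset.mul_prod_erase _ _ hu]
    congr 1
    have := (hz n).ne'
    have := (hz (n + 1)).ne'
    field_simp
  · rw [treeLaw, treeLaw, if_neg (hiff.not.2 h), if_neg h, zero_mul, zero_mul]

theorem sum_treeLaw_erase_mul_growthProb (ht : ∀ j, 0 ≤ t j) (hs : Summable t)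
    (hpos : ∃ j, 0 < t j) (n : ℕ) (τ : Finset UlamHarris) :
    ∑ u ∈ τ, treeLaw t n (τ.erase u) * ENNReal.ofReal (growthProb t u (τ.erase u)) =
      treeLaw t (n + 1) τ := by
  rw [Finset.sum_congr rfl fun u hu => treeLaw_erase_mul_growthProb ht hs hpos hu,
    ← Finset.mul_sum]
  by_cases h : treeLaw t (n + 1) τ = 0
  · rw [h, zero_mul]
  obtain ⟨hc, hn⟩ := parentClosed_card_of_treeLaw_ne_zero h
  have hw := vertexWeight_pos_of_treeLaw_ne_zero ht h
  have hz := treeWeight_pos ht hs hpos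
  rw [← ENNReal.ofReal_sum_of_nonneg fun u hu => mul_nonneg
      (div_nonneg (hz _).le (hz _).le) (div_nonneg (growthProb_nonneg ht hs _ _) (hw u hu).le),
    ← Finset.mul_sum, sum_growthProb_erase_div_vertexWeight ht hs hc hw, hn, lagRatio_succ,
    div_mul_div_cancel₀ (hz n).ne', div_self (hz (n + 1)).ne', ENNReal.ofReal_one, mul_one]

theorem growthKernel_apply_of_treeLaw_ne_zero (ht : ∀ j, 0 ≤ t j) (hs : Summable t)
    (hpos : ∃ j, 0 < t j) (hτ : treeLaw t n τ ≠ 0) (σ : Finset UlamHarris) :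
    growthKernel t τ σ =
      ∑' u, if σ = insert u τ then ENNReal.ofReal (growthProb t u τ) else 0 := by
  rw [growthKernel, dif_pos (tsum_growthProb ht hs hpos
    (parentClosed_card_of_treeLaw_ne_zero hτ).1 (vertexWeight_pos_of_treeLaw_ne_zero ht hτ))]
  refine (PMF.map_apply _ _ _).trans (tsum_congr fun u => ?_)
  split_ifs <;> rfl

theorem tsum_ite_insert_growthProb (f : Finset UlamHarris → ENNReal) (σ : Finset UlamHarris)
    (u : UlamHarris) :
    (∑' τ, if σ = insert u τ then f τ * ENNReal.ofReal (growthProb t u τ) else 0) =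
      if u ∈ σ then f (σ.erase u) * ENNReal.ofReal (growthProb t u (σ.erase u)) else 0 := by
  split_ifs with hu
  · rw [tsum_eq_single (σ.erase u), if_pos (Finset.insert_erase hu).symm]
    intro τ hτ
    split_ifs with hστ
    · have hg : growthProb t u τ = 0 := by
        by_contra hg
        exact hτ (by rw [hστ, Finset.erase_insert (notMem_of_growthProb_ne_zero hg)])
      rw [hg, ENNReal.ofReal_zero, mul_zero]
    · rfl
  · refine ENNReal.tsum_eq_zero.2 fun τ => if_neg ?_
    rintro rfl
    exact hu (Finset.mem_insert_self _ _)

theorem tsum_treeLaw_mul_growthKernel (ht : ∀ j, 0 ≤ t j) (hs : Summable t)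
    (hpos : ∃ j, 0 < t j) (n : ℕ) (σ : Finset UlamHarris) :
    ∑' τ, treeLaw t n τ * growthKernel t τ σ = treeLaw t (n + 1) σ := by
  have expand : ∀ τ, treeLaw t n τ * growthKernel t τ σ = ∑' u, if σ = insert u τ then
      treeLaw t n τ * ENNReal.ofReal (growthProb t u τ) else 0 := fun τ => by
    by_cases hτ : treeLaw t n τ = 0
    · simp [hτ]
    · rw [growthKernel_apply_of_treeLaw_ne_zero ht hs hpos hτ, ← ENNReal.tsum_mul_left]
      exact tsum_congr fun u => mul_ite_zero _ _ _
  rw [tsum_congr expand, ENNReal.tsum_comm, tsum_congr (tsum_ite_insert_growthProb _ σ),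
    tsum_eq_sum (s := σ) fun u hu => if_neg hu, ← sum_treeLaw_erase_mul_growthProb ht hs hpos]
  exact Finset.sum_congr rfl fun u hu => if_pos hu

theorem tsum_treeLaw (ht : ∀ j, 0 ≤ t j) (hs : Summable t) (hpos : ∃ j, 0 < t j) (n : ℕ) :
    ∑' τ, treeLaw t n τ = 1 := by
  induction n with
  | zero => rw [treeLaw_zero, PMF.tsum_coe]
  | succ n ih =>
    simp only [← tsum_treeLaw_mul_growthKernel ht hs hpos]
    rw [ENNReal.tsum_comm]
    simpa only [ENNReal.tsum_mul_left, PMF.tsum_coe, mul_one] using ih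

theorem ssubset_of_growthKernel_ne_zero (ht : ∀ j, 0 ≤ t j) (hs : Summable t)
    (hpos : ∃ j, 0 < t j) {σ : Finset UlamHarris} (hτ : treeLaw t n τ ≠ 0)
    (hσ : growthKernel t τ σ ≠ 0) : τ ⊂ σ := by
  rw [growthKernel_apply_of_treeLaw_ne_zero ht hs hpos hτ, Ne, ENNReal.tsum_eq_zero] at hσ
  push Not at hσ
  obtain ⟨u, hu⟩ := hσ
  obtain ⟨rfl, hg⟩ := ite_ne_right_iff.1 hu
  exact Finset.ssubset_insert (notMem_of_growthProb_ne_zero (t := t) fun h => hg (by simp [h]))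

end TreeLaw

section SubtreeMeasure

variable {θ : ℕ+ → ℝ} {n : ℕ}

theorem subtreeWeight_eq_prod (θ : ℕ+ → ℝ) (τ : Finset UlamHarris) :
    subtreeWeight θ τ = ∏ u ∈ τ, vertexWeight (fun j => θ j.succPNat) u := by
  classical
  let types : Finset ℕ+ := τ.biUnion fun u => u.getLast?.toFinset
  have pow_eq : ∀ i, θ i ^ (verticesOfType i τ).card =
      ∏ u ∈ τ, if u.getLast? = some i then θ i else 1 := fun i => by
    rw [← Finset.prod_filter, Finset.prod_const, verticesOfType]
    congr 2
    ext u
    simp [List.getLast?_eq_some_iff]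
  have weight_eq : subtreeWeight θ τ = ∏ i ∈ types, θ i ^ (verticesOfType i τ).card := by
    refine finprod_eq_prod_of_mulSupport_subset _ fun i hi => ?_
    obtain ⟨u, hu, hne⟩ := Finset.exists_ne_one_of_prod_ne_one ((pow_eq i).symm.trans_ne hi)
    exact Finset.mem_biUnion.2 ⟨u, hu, Option.mem_toFinset.2 (ite_ne_right_iff.1 hne).1⟩
  rw [weight_eq, Finset.prod_congr rfl fun i _ => pow_eq i, Finset.prod_comm]
  refine Finset.prod_congr rfl fun u hu => ?_
  rcases h : u.getLast? with _ | i
  · simp [vertexWeight, h]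
  · have hi : i ∈ types := Finset.mem_biUnion.2 ⟨u, hu, by simp [h]⟩
    simp [vertexWeight, h, hi]

theorem RootedSubtree.verts_injective : Function.Injective (RootedSubtree.verts (n := n)) :=
  fun _ _ => RootedSubtree.ext

instance RootedSubtree.instCountable (n : ℕ) : Countable (RootedSubtree n) :=
  RootedSubtree.verts_injective.countable

instance RootedSubtree.instDiscreteMeasurableSpace (n : ℕ) :
    DiscreteMeasurableSpace (RootedSubtree n) := ⟨fun _ => trivial⟩

theorem treeLaw_verts (hθ : ∀ i, 0 ≤ θ i) (hs : Summable fun j : ℕ => θ j.succPNat)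
    (hpos : ∃ j : ℕ, 0 < θ j.succPNat) (τ : RootedSubtree n) :
    treeLaw (fun j => θ j.succPNat) n τ.verts = ENNReal.ofReal (subtreeWeight θ τ.verts) /
      ENNReal.ofReal (treeWeight (fun j => θ j.succPNat) n) := by
  rw [treeLaw, if_pos ⟨τ.isRootedSubtree.2, τ.card_verts⟩, subtreeWeight_eq_prod,
    ENNReal.ofReal_div_of_pos (treeWeight_pos (fun j => hθ _) hs hpos n)]

theorem subtreePartition_eq_treeWeight (hθ : ∀ i, 0 ≤ θ i)
    (hs : Summable fun j : ℕ => θ j.succPNat) (hpos : ∃ j : ℕ, 0 < θ j.succPNat) (hn : n ≠ 0) :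
    subtreePartition θ n = ENNReal.ofReal (treeWeight (fun j => θ j.succPNat) n) := by
  have total := tsum_treeLaw (fun j => hθ _) hs hpos n
  rw [← RootedSubtree.verts_injective.tsum_eq, tsum_congr (treeLaw_verts hθ hs hpos)] at total
  · simp only [div_eq_mul_inv] at total
    rw [ENNReal.tsum_mul_right] at total
    exact (ENNReal.eq_inv_of_mul_eq_one_left total).trans (inv_inv _)
  · intro τ hτ
    obtain ⟨hc, hcard⟩ := parentClosed_card_of_treeLaw_ne_zero hτ
    exact ⟨⟨τ, ⟨Finset.card_ne_zero.1 (hcard ▸ hn), hc⟩, hcard⟩, rfl⟩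

theorem subtreeMeasure_singleton (hθ : ∀ i, 0 ≤ θ i)
    (hs : Summable fun j : ℕ => θ j.succPNat) (hpos : ∃ j : ℕ, 0 < θ j.succPNat) (hn : n ≠ 0)
    (τ : RootedSubtree n) :
    subtreeMeasure θ n {τ} = treeLaw (fun j => θ j.succPNat) n τ.verts := by
  rw [subtreeMeasure, Measure.sum_apply _ (measurableSet_singleton τ), tsum_eq_single τ,
    subtreePartition_eq_treeWeight hθ hs hpos hn, treeLaw_verts hθ hs hpos]
  · simp
  · intro σ hσ
    simp [hσ]

end SubtreeMeasure

/-! ### Markov chains with countable state space -/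

section MarkovChain

open Preorder Set

theorem map_eval_zero_trajMeasure {X : ℕ → Type*} [∀ n, MeasurableSpace (X n)]
    (μ : Measure (X 0)) (K : (n : ℕ) → Kernel (Π i : Finset.Iic n, X i) (X (n + 1)))
    [∀ n, IsMarkovKernel (K n)] :
    (Kernel.trajMeasure μ K).map (fun ω => ω 0) = μ := by
  let e : (Π i : Finset.Iic 0, X i) ≃ᵐ X 0 := MeasurableEquiv.piUnique _
  have restrict_eq : (Kernel.trajMeasure μ K).map (frestrictLe 0) = μ.map e.symm := by
    rw [Kernel.trajMeasure, Measure.map_comp _ _ (by fun_prop), Kernel.traj_map_frestrictLe,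
      Kernel.partialTraj_self, Measure.id_comp]
    rfl
  have map_eq := Measure.map_map (μ := Kernel.trajMeasure μ K) e.measurable
    (measurable_frestrictLe 0)
  rw [restrict_eq, MeasurableEquiv.map_map_symm] at map_eq
  exact map_eq.symm

variable {α : Type*} [MeasurableSpace α] {κ : α → PMF α} {P : Measure (ℕ → α)}

/-- `P` is the law of a homogeneous Markov chain with transition probabilities `κ`: given an
event `A` of the past under which the present state is `x`, the next state is `y` with
probability `κ x y`. -/
def IsMarkovChainLaw (κ : α → PMF α) (P : Measure (ℕ → α)) : Prop :=
  ∀ (n : ℕ) (A : Set (ℕ → α)) (x y : α), MeasurableSet[Filtration.piLE (X := fun _ => α) n] A →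
    (∀ ω ∈ A, ω n = x) → P (A ∩ {ω | ω (n + 1) = y}) = P A * κ x y

theorem cond_preimage_of_measurePreserving {Ω Ω' : Type*} [MeasurableSpace Ω]
    [MeasurableSpace Ω'] {μ : Measure Ω} {ν : Measure Ω'} {f : Ω → Ω'}
    (hf : MeasurePreserving f μ ν) {s t : Set Ω'} (hs : MeasurableSet s) (ht : MeasurableSet t) :
    μ[f ⁻¹' t | f ⁻¹' s] = ν[t | s] := by
  rw [cond_apply (hf.measurable hs), cond_apply hs, ← preimage_inter,
    hf.measure_preimage hs.nullMeasurableSet, hf.measure_preimage (hs.inter ht).nullMeasurableSet]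

theorem IsMarkovChainLaw.cond_eq [IsFiniteMeasure P] (hP : IsMarkovChainLaw κ P) {n : ℕ}
    {A : Set (ℕ → α)} {x : α} (hA : MeasurableSet[Filtration.piLE (X := fun _ => α) n] A)
    (hx : ∀ ω ∈ A, ω n = x) (hne : P A ≠ 0) (y : α) : P[{ω | ω (n + 1) = y} | A] = κ x y := by
  rw [cond_apply (Filtration.piLE.le n A hA), hP n A x y hA hx, ← mul_assoc,
    ENNReal.inv_mul_cancel hne (measure_ne_top _ _), one_mul]

variable [MeasurableSingletonClass α]

theorem measurableSet_piLE_setOf_eval_eq {k n : ℕ} (hk : k ≤ n) (x : α) :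
    MeasurableSet[Filtration.piLE (X := fun _ => α) n] {ω | ω k = x} :=
  ⟨_, (measurable_pi_apply (⟨k, hk⟩ : Iic n)) (measurableSet_singleton x), rfl⟩

theorem measurableSet_setOf_eval_eq (n : ℕ) (x : α) : MeasurableSet {ω : ℕ → α | ω n = x} :=
  Filtration.piLE.le n _ (measurableSet_piLE_setOf_eval_eq le_rfl x)

theorem IsMarkovChainLaw.measure_eq_and_succ_eq (hP : IsMarkovChainLaw κ P) (n : ℕ) (x y : α) :
    P {ω | ω n = x ∧ ω (n + 1) = y} = P {ω | ω n = x} * κ x y :=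
  hP n {ω | ω n = x} x y (measurableSet_piLE_setOf_eval_eq le_rfl x) fun _ => id

theorem IsMarkovChainLaw.isMarkovProcess [IsFiniteMeasure P] (hP : IsMarkovChainLaw κ P)
    {Ω : Type*} [MeasurableSpace Ω] {Q : Measure Ω} {π : Ω → ℕ → α}
    (hπ : MeasurePreserving π Q P) {S : ℕ+ → Type*} {X : (n : ℕ+) → Ω → S n}
    {code : (n : ℕ+) → S n → α} (hcode : ∀ n, Function.Injective (code n))
    (hX : ∀ n ω, code n (X n ω) = π ω n) : IsMarkovProcess Q X := by
  intro n x hne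
  have event_eq : ∀ k, {ω | X k ω = x k} = π ⁻¹' {ω | ω k = code k (x k)} := fun k => by
    ext ω
    exact (hcode k).eq_iff.symm.trans (by rw [hX]; rfl)
  let past : Set (ℕ → α) := ⋂ (k : ℕ+) (_ : k ≤ n), {ω | ω k = code k (x k)}
  let present : Set (ℕ → α) := {ω | ω n = code n (x n)}
  have past_eq : {ω | ∀ k ≤ n, X k ω = x k} = π ⁻¹' past := by
    simp only [past, preimage_iInter, ← event_eq]
    ext ω
    simp
  have past_subset : past ⊆ present := fun ω hω => mem_iInter₂.1 hω n le_rfl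
  have past_meas : MeasurableSet[Filtration.piLE (X := fun _ => α) (n : ℕ)] past :=
    MeasurableSet.iInter fun k => MeasurableSet.iInter fun hk =>
      measurableSet_piLE_setOf_eval_eq hk _
  have present_meas : MeasurableSet[Filtration.piLE (X := fun _ => α) (n : ℕ)] present :=
    measurableSet_piLE_setOf_eval_eq le_rfl _
  have past_ne : P past ≠ 0 := by
    rwa [← hπ.measure_preimage (Filtration.piLE.le _ _ past_meas).nullMeasurableSet, ← past_eq]
  have present_ne : P present ≠ 0 := fun h => past_ne (measure_mono_null past_subset h)
  have next_meas := measurableSet_setOf_eval_eq (n + 1 : ℕ+) (code (n + 1) (x (n + 1)))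
  rw [past_eq, event_eq n, event_eq (n + 1),
    cond_preimage_of_measurePreserving hπ (Filtration.piLE.le _ _ past_meas) next_meas,
    cond_preimage_of_measurePreserving hπ (Filtration.piLE.le _ _ present_meas) next_meas]
  exact (hP.cond_eq past_meas past_subset past_ne _).trans
    (hP.cond_eq present_meas (fun _ => id) present_ne _).symm

variable [Countable α]

theorem IsMarkovChainLaw.measure_eq (hP : IsMarkovChainLaw κ P) {μ : ℕ → α → ENNReal}
    (hzero : ∀ x, P {ω | ω 0 = x} = μ 0 x)
    (hsucc : ∀ n y, ∑' x, μ n x * κ x y = μ (n + 1) y) (n : ℕ) (x : α) :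
    P {ω | ω n = x} = μ n x := by
  induction n generalizing x with
  | zero => exact hzero x
  | succ n ih =>
    have partition : {ω : ℕ → α | ω (n + 1) = x} = ⋃ z, {ω | ω n = z ∧ ω (n + 1) = x} := by
      ext ω
      simp
    rw [partition, measure_iUnion, ← hsucc]
    · simp only [hP.measure_eq_and_succ_eq, ih]
    · exact fun z z' hz => disjoint_left.2 fun ω h h' => hz (h.1.symm.trans h'.1)
    · exact fun z => (measurableSet_setOf_eval_eq n z).inter
        (measurableSet_setOf_eval_eq (n + 1) x)

theorem IsMarkovChainLaw.ae_rel (hP : IsMarkovChainLaw κ P) {R : ℕ → α → α → Prop}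
    (hR : ∀ n x y, P {ω | ω n = x} ≠ 0 → κ x y ≠ 0 → R n x y) :
    ∀ᵐ ω ∂P, ∀ n, R n (ω n) (ω (n + 1)) := by
  have rel : ∀ n x y, ∀ᵐ ω ∂P, ω n = x ∧ ω (n + 1) = y → R n x y := fun n x y => by
    by_cases hxy : R n x y
    · exact ae_of_all _ fun _ _ => hxy
    · have null : P {ω | ω n = x ∧ ω (n + 1) = y} = 0 := by
        rw [hP.measure_eq_and_succ_eq]
        by_contra h
        exact hxy (hR n x y (left_ne_zero_of_mul h) (right_ne_zero_of_mul h))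
      exact (measure_eq_zero_iff_ae_notMem.1 null).mono fun ω h h' => absurd h' h
  have all_rel : ∀ᵐ ω ∂P, ∀ n x y, ω n = x ∧ ω (n + 1) = y → R n x y :=
    ae_all_iff.2 fun n => ae_all_iff.2 fun x => ae_all_iff.2 (rel n x)
  exact all_rel.mono fun ω h n => h n _ _ ⟨rfl, rfl⟩

theorem exists_isMarkovChainLaw (μ : PMF α) (κ : α → PMF α) :
    ∃ P : Measure (ℕ → α), IsProbabilityMeasure P ∧ (∀ x, P {ω | ω 0 = x} = μ x) ∧
      IsMarkovChainLaw κ P := by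
  let K : (n : ℕ) → Kernel (Π _ : Finset.Iic n, α) α := fun n =>
    ⟨fun h => (κ (h ⟨n, Finset.mem_Iic.2 le_rfl⟩)).toMeasure,
      (Measurable.of_discrete (f := fun a => (κ a).toMeasure)).comp (measurable_pi_apply _)⟩
  have : ∀ n, IsMarkovKernel (K n) := fun n => ⟨fun h => PMF.toMeasure.isProbabilityMeasure _⟩
  let P := Kernel.trajMeasure (X := fun _ => α) μ.toMeasure K
  refine ⟨P, inferInstance, fun x => ?_, fun n A x y hA hx => ?_⟩
  · rw [← μ.toMeasure_apply_singleton x (measurableSet_singleton x),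
      ← map_eval_zero_trajMeasure (X := fun _ => α) μ.toMeasure K,
      Measure.map_apply (measurable_pi_apply 0) (measurableSet_singleton x)]
    rfl
  · rw [Filtration.piLE_eq_comap_frestrictLe] at hA
    obtain ⟨B, hB, rfl⟩ := hA
    let r : (ℕ → α) → (Π _ : Finset.Iic n, α) := frestrictLe n
    have hr : Measurable r := measurable_frestrictLe n
    calc P (r ⁻¹' B ∩ {ω | ω (n + 1) = y})
        = P.map (fun ω => (r ω, ω (n + 1))) (B ×ˢ {y}) :=
          (Measure.map_apply (hr.prodMk (measurable_pi_apply _))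
            (hB.prod (measurableSet_singleton y))).symm
      _ = (P.map r ⊗ₘ K n) (B ×ˢ {y}) := by
          rw [← Kernel.map_frestrictLe_trajMeasure_compProd_eq_map_trajMeasure]
      _ = ∫⁻ h in B, K n h {y} ∂P.map r :=
          Measure.compProd_apply_prod hB (measurableSet_singleton y)
      _ = ∫⁻ ω in r ⁻¹' B, κ (ω n) y ∂P := by
          rw [setLIntegral_map hB ((K n).measurable_coe (measurableSet_singleton y)) hr]
          exact lintegral_congr fun ω =>
            PMF.toMeasure_apply_singleton _ y (measurableSet_singleton y)
      _ = P (r ⁻¹' B) * κ x y := by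
          rw [setLIntegral_congr_fun (hr hB) fun ω hω => by rw [hx ω hω], setLIntegral_const,
            mul_comm]

end MarkovChain

/-! ### The growing tree -/

section GrowingTree

/-- Finite sets of vertices carry the discrete σ-algebra. -/
instance instMeasurableSpaceFinsetUlamHarris : MeasurableSpace (Finset UlamHarris) := ⊤

instance instDiscreteMeasurableSpaceFinsetUlamHarris :
    DiscreteMeasurableSpace (Finset UlamHarris) := ⟨fun _ => trivial⟩

/-- A path of possibly empty trees that has `n` vertices at time `n` and grows at each step. -/
def IsGrowing (ω : ℕ → Finset UlamHarris) : Prop :=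
  ∀ n, (ParentClosed (ω n) ∧ (ω n).card = n) ∧ ω n ⊂ ω (n + 1)

/-- The tree at the positive time `n` of a growing path, which is nonempty and hence a rooted
subtree. -/
def IsGrowing.treeAt {ω : ℕ → Finset UlamHarris} (h : IsGrowing ω) (n : ℕ+) : RootedSubtree n where
  verts := ω n
  isRootedSubtree := ⟨Finset.card_pos.1 ((h n).1.2.symm ▸ n.pos), (h n).1.1⟩
  card_verts := (h n).1.2

theorem measurableSet_setOf_isGrowing : MeasurableSet {ω | IsGrowing ω} := by
  have : {ω | IsGrowing ω} = ⋂ n, (fun ω : ℕ → Finset UlamHarris => (ω n, ω (n + 1))) ⁻¹'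
      {p | (ParentClosed p.1 ∧ p.1.card = n) ∧ p.1 ⊂ p.2} := by
    ext ω
    simp [IsGrowing]
  rw [this]
  exact MeasurableSet.iInter fun n => measurableSet_preimage (by fun_prop) (.of_discrete)

theorem preimage_treeAt_singleton (n : ℕ+) (τ : RootedSubtree n) :
    (fun ω : {ω // IsGrowing ω} => ω.2.treeAt n) ⁻¹' {τ} = {ω | ω.1 n = τ.verts} :=
  Set.ext fun _ => RootedSubtree.ext_iff

theorem measurable_treeAt (n : ℕ+) :
    Measurable fun ω : {ω // IsGrowing ω} => ω.2.treeAt n := by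
  refine measurable_to_countable' fun τ => ?_
  rw [preimage_treeAt_singleton]
  exact measurable_subtype_coe (measurableSet_setOf_eval_eq _ _)

theorem measurePreserving_subtype_val_of_ae {α : Type*} [MeasurableSpace α] {μ : Measure α}
    {p : α → Prop} (hp : MeasurableSet {x | p x}) (hμ : ∀ᵐ x ∂μ, p x) :
    MeasurePreserving (Subtype.val : {x // p x} → α) (μ.comap Subtype.val) μ := by
  have := measurePreserving_subtype_coe (μa := μ) hp
  rwa [Measure.restrict_eq_self_of_ae_mem (s := {x | p x}) hμ] at this

theorem exists_growingTree {t : ℕ → ℝ} (ht : ∀ j, 0 ≤ t j) (hs : Summable t)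
    (hpos : ∃ j, 0 < t j) :
    ∃ Q : Measure {ω // IsGrowing ω}, IsProbabilityMeasure Q ∧
      (∀ n τ, Q {ω | ω.1 n = τ} = treeLaw t n τ) ∧
      IsMarkovChainLaw (growthKernel t) (Q.map Subtype.val) := by
  obtain ⟨P, hP, hzero, hchain⟩ := exists_isMarkovChainLaw (PMF.pure ∅) (growthKernel t)
  have law : ∀ n τ, P {ω | ω n = τ} = treeLaw t n τ :=
    hchain.measure_eq (fun τ => by rw [hzero, treeLaw_zero])
      (tsum_treeLaw_mul_growthKernel ht hs hpos)
  have growing : ∀ᵐ ω ∂P, IsGrowing ω := by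
    refine hchain.ae_rel (R := fun n τ σ => (ParentClosed τ ∧ τ.card = n) ∧ τ ⊂ σ) ?_
    intro n τ σ hτ hσ
    rw [law] at hτ
    exact ⟨parentClosed_card_of_treeLaw_ne_zero hτ,
      ssubset_of_growthKernel_ne_zero ht hs hpos hτ hσ⟩
  have hval := measurePreserving_subtype_val_of_ae measurableSet_setOf_isGrowing growing
  refine ⟨_, ?_, fun n τ => ?_, by rwa [hval.map_eq]⟩
  · rw [← hval.map_eq] at hP
    exact Measure.isProbabilityMeasure_of_map Subtype.val
  · rw [← law]
    exact hval.measure_preimage (measurableSet_setOf_eval_eq n τ).nullMeasurableSet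

end GrowingTree

theorem theorem3 (θ : ℕ+ → ℝ) (hθ : ∀ i, 0 ≤ θ i) (hsum : Summable θ)
    (hpos : 0 < ∑' i, θ i) :
    ∃ (Ω : Type) (_ : MeasurableSpace Ω) (P : Measure Ω) (_ : IsProbabilityMeasure P)
      (T : (n : ℕ+) → Ω → RootedSubtree n),
      (∀ n, Measurable (T n)) ∧
      (∀ n, P.map (T n) = subtreeMeasure θ n) ∧
      IsMarkovProcess P T ∧
      ∀ (n : ℕ+) (ω : Ω), (T n ω).verts ⊂ (T (n + 1) ω).verts := by
  have hs : Summable fun j : ℕ => θ j.succPNat := Equiv.pnatEquivNat.symm.summable_iff.2 hsum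
  have hpos' : ∃ j : ℕ, 0 < θ j.succPNat := by
    contrapose! hpos
    rw [← Equiv.pnatEquivNat.symm.tsum_eq]
    exact tsum_nonpos hpos
  obtain ⟨P, hP, law, chain⟩ := exists_growingTree (fun j => hθ j.succPNat) hs hpos'
  refine ⟨{ω // IsGrowing ω}, inferInstance, P, hP, fun n ω => ω.2.treeAt n, measurable_treeAt,
    fun n => Measure.ext_of_singleton fun τ => ?_, ?_, fun n ω => (ω.2 n).2⟩
  · rw [Measure.map_apply (measurable_treeAt n) (measurableSet_singleton τ),
      preimage_treeAt_singleton, law, subtreeMeasure_singleton hθ hs hpos' n.ne_zero]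
  · have : IsProbabilityMeasure (P.map Subtype.val) :=
      Measure.isProbabilityMeasure_map measurable_subtype_coe.aemeasurable
    exact chain.isMarkovProcess (measurable_subtype_coe.measurePreserving P)
      (fun n => RootedSubtree.verts_injective) fun n ω => rfl
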